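/- Let $n\ge 2$ and consider $\mathbb R^{n+1}$ with coordinates $\mathbf x=(x^0,\dots,x^n)$; write also $x=x^0$, $y^j=x^j$ for $1\le j\le n$, $\mathbf y=(y^1,\dots,y^n)$, and a dot for $d/dx$. A Finsler metric on an open set $W\subseteq\mathbb R^{n+1}$ is a function $F(\mathbf x,\mathbf x_t)>0$, defined and smooth for all $\mathbf x\in W$ and all $\mathbf x_t\ne 0$, with $F(\mathbf x,\lambda\mathbf x_t)=\lambda F(\mathbf x,\mathbf x_t)$ for $\lambda>0$, such that the Hessian of $F^2$ with respect to $\mathbf x_t$ is positive definite at every $\mathbf x_t\neq0$. Its geodesics are the smooth regular curves (parametrized by an open interval, with any parametrization) which satisfy the Euler–Lagrange equations $\frac{d}{dt}\frac{\partial F}{\partial x^i_t}=\frac{\partial F}{\partial x^i}$. 1. (Non-metrizability.) Let $W\subseteq\mathbb R^{n+1}$ be open and nonempty. There is no Finsler metric on $W$ for which the geodesics of the form $x\mapsto(x,\mathbf y(x))$ in $W$ are precisely those given by the solutions of $$\ddot y^1=y^2,\qquad \ddot y^j=0\quad(2\le j\le n).\tag{a}$$ The same holds for the system $$\ddot y^j=2y^1\dot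 y^1\dot y^2\dot y^j\quad(1\le j\le n).\tag{b}$$ There is also no Finsler metric on $W$ whose geodesics are precisely the paths in $W$ of the Egorov projective structure, i.e. the smooth regular curves satisfying, for some function $\nu(t)$, $x^i_{tt}+\sum_{j,k}\Gamma^i_{jk}x^j_tx^k_t=\nu x^i_t$ $(0\le i\le n)$, where $\Gamma^0_{12}=\Gamma^0_{21}=x^1$ and all other $\Gamma^i_{jk}$ vanish. 2. (General solution of the fundamental system.) For a system $\ddot{\mathbf y}=\mathbf f(x,\mathbf y,\dot{\mathbf y})$ put $\frac{d}{dx}=\partial_x+\dot y^i\partial_{y^i}+f^i\partial_{\dot y^i}$ and $A_i^j=\frac{d}{dx}\frac{\partial f^j}{\partial\dot y^i}-2\frac{\partial f^j}{\partial y^i}-\frac12\frac{\partial f^k}{\partial\dot y^i}\frac{\partial f^j}{\partial\dot y^k}$ (summation over repeated indices). The fundamental system for a smooth field $\phi_{ij}(x,\mathbf y,\dot{\mathbf y})$ of symmetric nondegenerate matrices on an open set $U\subseteq\mathbb R\times\mathbb R^n\times\mathbb R^n$ is $$\frac{\partial\phi_{ik}}{\partial\dot y^j}=\frac{\partial\phi_{jk}}{\partial\dot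 y^i},\qquad \frac{d}{dx}\phi_{ij}+\frac12\frac{\partial f^k}{\partial\dot y^i}\phi_{kj}+\frac12\frac{\partial f^k}{\partial\dot y^j}\phi_{ki}=0,\qquad A_i^k\phi_{kj}=A_j^k\phi_{ki}.$$ For the system (a), such a field $\phi$ satisfies the fundamental system on $U$ if and only if on $U$ $$\frac{\partial\phi_{ik}}{\partial\dot y^j}=\frac{\partial\phi_{jk}}{\partial\dot y^i},\qquad \phi_{11}=\phi_{13}=\dots=\phi_{1n}=0,\qquad \phi_{12}\ne0,\qquad \frac{d}{dx}\phi_{ij}=0 .$$ 3. (Form of the Lagrangian.) Let $U$ be open such that every line parallel to the $\dot y^1$-axis meets $U$ in an interval or not at all, and let $C U$ be the set of $(\mathbf x,\mathbf x_t)$ with $x^0_t>0$ and $(\mathbf x,x^1_t/x^0_t,\dots,x^n_t/x^0_t)\in U$. Let $\hat L$ be smooth on $CU$, positively homogeneous of degree one in $\mathbf x_t$, put $L(x,\mathbf y,\dot{\mathbf y})=\hat L(x,\mathbf y,1,\dot{\mathbf y})$, and suppose that $\phi_{ij}=\frac{\partial^2L}{\partial\dot y^i\partial\dot y^j}$ is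 nondegenerate and satisfies the fundamental system for (a) on $U$. Then there are functions $\psi_0,\psi_1$, smooth on the image of $CU$ under $(\mathbf x,\mathbf x_t)\mapsto(\mathbf x,\frac{x^2_t}{x^0_t},\dots,\frac{x^n_t}{x^0_t})$, such that on $CU$ $$\hat L(\mathbf x,\mathbf x_t)=\psi_0\Bigl(\mathbf x,\tfrac{x^2_t}{x^0_t},\dots,\tfrac{x^n_t}{x^0_t}\Bigr)x^0_t+\psi_1\Bigl(\mathbf x,\tfrac{x^2_t}{x^0_t},\dots,\tfrac{x^n_t}{x^0_t}\Bigr)x^1_t .$$ 4. (Non-convexity.) Let $\psi_0,\psi_1:\mathbb R^{n-1}\to\mathbb R$ be any functions and let $\hat L(\mathbf x_t)=\psi_0\bigl(\frac{x^2_t}{x^0_t},\dots,\frac{x^n_t}{x^0_t}\bigr)x^0_t+\psi_1\bigl(\frac{x^2_t}{x^0_t},\dots,\frac{x^n_t}{x^0_t}\bigr)x^1_t$. Then $\hat L^2$ is not strictly convex on the half-space $\{x^0_t>0\}$. Moreover, the Hessian of $\hat L^2$ is not positive definite at any $\mathbf x_t$ with $x^0_t\ne0$ such that $\psi_0,\psi_1$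 are of class $C^2$ near $\bigl(\frac{x^2_t}{x^0_t},\dots,\frac{x^n_t}{x^0_t}\bigr)$. -/

import Mathlib

open Set
open scoped ContDiff

noncomputable section

namespace PathGeom

/-- Coordinate space of points (or of velocities): a vector `(x⁰, …, xᵏ⁻¹)`. -/
abbrev Crd (k : ℕ) : Type := Fin k → ℝ

/-- The space of 1-jets `(x, y, ẏ)` of vector functions `y = (y¹, …, yⁿ)` of one variable `x`.
The component `yʲ` is `y (j - 1)`, as `Fin n` counts from zero. -/
abbrev Jet (n : ℕ) : Type := ℝ × Crd n × Crd n

/-! ### Lagrangians, extremals and Finsler metrics -/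

/-- The `i`-th partial derivative of a function on coordinate space. -/
def pd {k : ℕ} (i : Fin k) (g : Crd k → ℝ) (v : Crd k) : ℝ :=
  fderiv ℝ g v (Pi.single i 1)

/-- The Hessian of `g` at `v` is positive definite. -/
def HessPosDef {k : ℕ} (g : Crd k → ℝ) (v : Crd k) : Prop :=
  ∀ w : Crd k, w ≠ 0 → 0 < fderiv ℝ (fderiv ℝ g) v w w

/-- `F` is a (smooth, strongly convex, positively homogeneous, not necessarily reversible)
Finsler metric on the open set `W`, defined on all nonzero tangent vectors over `W`. -/
structure IsFinsler {k : ℕ} (W : Set (Crd k)) (F : Crd k → Crd k → ℝ) : Prop where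
  smooth : ContDiffOn ℝ ∞ (fun q : Crd k × Crd k => F q.1 q.2) (W ×ˢ {v | v ≠ 0})
  pos : ∀ x ∈ W, ∀ v, v ≠ 0 → 0 < F x v
  homog : ∀ x ∈ W, ∀ v, v ≠ 0 → ∀ c : ℝ, 0 < c → F x (c • v) = c * F x v
  convex : ∀ x ∈ W, ∀ v, v ≠ 0 → HessPosDef (fun u => F x u ^ 2) v

/-- A smooth regular curve in `W`, parametrized by the open interval `I`. -/
structure IsRegularCurve {k : ℕ} (W : Set (Crd k)) (I : Set ℝ) (γ : ℝ → Crd k) : Prop where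
  isOpen : IsOpen I
  interval : I.OrdConnected
  smooth : ContDiffOn ℝ ∞ γ I
  regular : ∀ t ∈ I, deriv γ t ≠ 0
  mem : ∀ t ∈ I, γ t ∈ W

/-- The curve `γ` satisfies on `I` the Euler-Lagrange equations
`d/dt (∂F/∂xⁱ_t) = ∂F/∂xⁱ` of the Lagrangian `F(x, x_t)`. -/
def IsExtremal {k : ℕ} (F : Crd k → Crd k → ℝ) (I : Set ℝ) (γ : ℝ → Crd k) : Prop :=
  ∀ t ∈ I, ∀ i : Fin k,
    HasDerivAt (fun s => pd i (F (γ s)) (deriv γ s))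
      (pd i (fun x => F x (deriv γ t)) (γ t)) t

/-! ### Path structures -/

/-- `γ` solves `xⁱ_tt + hⁱ(x, x_t) = ν xⁱ_t` on `I` for some function `ν`. -/
def IsPath {k : ℕ} (h : Crd k → Crd k → Crd k) (I : Set ℝ) (γ : ℝ → Crd k) : Prop :=
  ∃ ν : ℝ → ℝ, ∀ t ∈ I, ∀ i : Fin k,
    deriv (deriv γ) t i + h (γ t) (deriv γ t) i = ν t * deriv γ t i

/-- The quadratic functions `hⁱ = ∑ Γⁱ_{jk} xʲ_t xᵏ_t` of a projective structure;
`Γ x i j k` is `Γⁱ_{jk}(x)`. -/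
def quadraticOf {k : ℕ} (Γ : Crd k → Fin k → Fin k → Fin k → ℝ) (x v : Crd k) : Crd k :=
  fun i => ∑ j, ∑ l, Γ x i j l * v j * v l

/-- The path structure `xⁱ_tt + hⁱ(x, x_t) = ν xⁱ_t` on `W` is Finsler metrizable:
the geodesics of some Finsler metric on `W` are precisely its paths. -/
def IsFinslerMetrizable {k : ℕ} (h : Crd k → Crd k → Crd k) (W : Set (Crd k)) : Prop :=
  ∃ F : Crd k → Crd k → ℝ, IsFinsler W F ∧
    ∀ (I : Set ℝ) (γ : ℝ → Crd k), IsRegularCurve W I γ → (IsExtremal F I γ ↔ IsPath h I γ)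

/-- `y` solves `ÿ = f(x, y, ẏ)` on `I`. -/
def IsSolution {n : ℕ} (f : Jet n → Crd n) (I : Set ℝ) (y : ℝ → Crd n) : Prop :=
  ∀ x ∈ I, deriv (deriv y) x = f (x, y x, deriv y x)

/-- The curve `x ↦ (x, y(x))`. -/
def graphCurve {n : ℕ} (y : ℝ → Crd n) : ℝ → Crd (n + 1) := fun x => Fin.cons x (y x)

/-- The path structure on `W` given by the system `ÿ = f(x, y, ẏ)`, whose paths are the curves
`x ↦ (x, y(x))` with `y` a solution, is Finsler metrizable: for some Finsler metric on `W` the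
geodesics of the form `x ↦ (x, y(x))` are precisely these paths. Nothing is asked about the
remaining directions, in which the system does not define paths. -/
def IsFinslerMetrizableODE {n : ℕ} (f : Jet n → Crd n) (W : Set (Crd (n + 1))) : Prop :=
  ∃ F : Crd (n + 1) → Crd (n + 1) → ℝ, IsFinsler W F ∧
    ∀ (I : Set ℝ) (y : ℝ → Crd n), IsRegularCurve W I (graphCurve y) →
      (IsExtremal F I (graphCurve y) ↔ IsSolution f I y)

/-- The Egorov projective structure in dimension `n + 1`, `n = m + 2`, in the coordinates
`x⁰, …, xⁿ`: the only nonzero coefficients are `Γ⁰₁₂ = Γ⁰₂₁ = x¹`. -/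
def egorovΓ (m : ℕ) (x : Crd (m + 3)) (i j k : Fin (m + 3)) : ℝ :=
  if i = 0 ∧ ((j = 1 ∧ k = 2) ∨ (j = 2 ∧ k = 1)) then x 1 else 0

/-- Right-hand side of `ÿʲ = 2 y¹ ẏ¹ ẏ² ẏʲ`, `1 ≤ j ≤ n`, `n = m + 2`. -/
def egorovODE (m : ℕ) (z : Jet (m + 2)) : Crd (m + 2) :=
  fun j => 2 * z.2.1 0 * z.2.2 0 * z.2.2 1 * z.2.2 j

/-- Right-hand side of `ÿ¹ = y²`, `ÿʲ = 0` for `2 ≤ j ≤ n`, `n = m + 2`. -/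
def linearODE (m : ℕ) (z : Jet (m + 2)) : Crd (m + 2) :=
  fun j => if j = 0 then z.2.1 1 else 0

/-! ### The fundamental system of the inverse variational problem -/

/-- `∂g/∂yⁱ`. -/
def pdPos {n : ℕ} (i : Fin n) (g : Jet n → ℝ) (z : Jet n) : ℝ :=
  fderiv ℝ g z (0, Pi.single i 1, 0)

/-- `∂g/∂ẏⁱ`. -/
def pdVel {n : ℕ} (i : Fin n) (g : Jet n → ℝ) (z : Jet n) : ℝ :=
  fderiv ℝ g z (0, 0, Pi.single i 1)

/-- The total derivative `d/dx = ∂_x + ẏⁱ ∂_{yⁱ} + fⁱ ∂_{ẏⁱ}`. -/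
def totalDeriv {n : ℕ} (f : Jet n → Crd n) (g : Jet n → ℝ) (z : Jet n) : ℝ :=
  fderiv ℝ g z (1, z.2.2, f z)

/-- `douglasA f i j` is
`Aᵢʲ = d/dx (∂fʲ/∂ẏⁱ) - 2 ∂fʲ/∂yⁱ - (1/2) ∑ₖ (∂fᵏ/∂ẏⁱ) (∂fʲ/∂ẏᵏ)`. -/
def douglasA {n : ℕ} (f : Jet n → Crd n) (i j : Fin n) (z : Jet n) : ℝ :=
  totalDeriv f (pdVel i fun z' => f z' j) z - 2 * pdPos i (fun z' => f z' j) z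
    - (1 / 2) * ∑ k, pdVel i (fun z' => f z' k) z * pdVel k (fun z' => f z' j) z

/-- A smooth field of symmetric nondegenerate matrices on `U`. -/
structure IsMetricField {n : ℕ} (U : Set (Jet n)) (φ : Jet n → Matrix (Fin n) (Fin n) ℝ) :
    Prop where
  smooth : ∀ i j, ContDiffOn ℝ ∞ (fun z => φ z i j) U
  symm : ∀ z ∈ U, (φ z).IsSymm
  nondeg : ∀ z ∈ U, (φ z).det ≠ 0

/-- The condition `∂φᵢₖ/∂ẏʲ = ∂φⱼₖ/∂ẏⁱ` on `U`. -/
def IsVelClosed {n : ℕ} (U : Set (Jet n)) (φ : Jet n → Matrix (Fin n) (Fin n) ℝ) : Prop :=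
  ∀ z ∈ U, ∀ i j k, pdVel j (fun z' => φ z' i k) z = pdVel i (fun z' => φ z' j k) z

/-- The fundamental system on `φ` for the equation `ÿ = f(x, y, ẏ)`, on `U`. -/
structure FundamentalSystem {n : ℕ} (f : Jet n → Crd n) (U : Set (Jet n))
    (φ : Jet n → Matrix (Fin n) (Fin n) ℝ) : Prop where
  closed : IsVelClosed U φ
  transport : ∀ z ∈ U, ∀ i j,
    totalDeriv f (fun z' => φ z' i j) z
      + (1 / 2) * ∑ k, pdVel i (fun z' => f z' k) z * φ z k j
      + (1 / 2) * ∑ k, pdVel j (fun z' => f z' k) z * φ z k i = 0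
  symmetric : ∀ z ∈ U, ∀ i j, ∑ k, douglasA f i k z * φ z k j =
    ∑ k, douglasA f j k z * φ z k i

/-- The nonautonomous Lagrangian `L(x, y, ẏ) = L̂(x, y, 1, ẏ)`. -/
def dehomogenize {n : ℕ} (Lhat : Crd (n + 1) → Crd (n + 1) → ℝ) (z : Jet n) : ℝ :=
  Lhat (Fin.cons z.1 z.2.1) (Fin.cons 1 z.2.2)

/-- The matrix `φᵢⱼ = ∂²L/∂ẏⁱ∂ẏʲ`. -/
def velHessian {n : ℕ} (L : Jet n → ℝ) (z : Jet n) : Matrix (Fin n) (Fin n) ℝ :=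
  Matrix.of fun i j => pdVel i (pdVel j L) z

/-- The cone over `U`: the pairs `(x, x_t)` with `x⁰_t > 0` and
`(x⁰, (x¹, …, xⁿ), (x¹_t/x⁰_t, …, xⁿ_t/x⁰_t)) ∈ U`. -/
def coneOver {n : ℕ} (U : Set (Jet n)) : Set (Crd (n + 1) × Crd (n + 1)) :=
  {q | 0 < q.2 0 ∧ (q.1 0, Fin.tail q.1, fun j : Fin n => q.2 j.succ / q.2 0) ∈ U}

/-- The ratios `(x²_t/x⁰_t, …, xⁿ_t/x⁰_t)`, `n = m + 2`. -/
def ratios {m : ℕ} (v : Crd (m + 3)) : Crd (m + 1) := fun j => v j.succ.succ / v 0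

/-- The function `ψ₀(x²_t/x⁰_t, …, xⁿ_t/x⁰_t) x⁰_t + ψ₁(x²_t/x⁰_t, …, xⁿ_t/x⁰_t) x¹_t`. -/
def egorovForm {m : ℕ} (ψ₀ ψ₁ : Crd (m + 1) → ℝ) (v : Crd (m + 3)) : ℝ :=
  ψ₀ (ratios v) * v 0 + ψ₁ (ratios v) * v 1

end PathGeom

end

open PathGeom

/-! Non-metrizability is a conservation argument. If a curve `c` and all small perturbations `c + a
• J`, with `J` in a linear space of fields, are extremals, then each `J` satisfies the linearized
Euler-Lagrange equations, and the symplectic form of the Lagrangian on any two such fields is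
constant along `c` (`hasDerivAt_symplecticPairing`). In all three cases there is a four-dimensional
space of fields in a coordinate plane `(α, β)`, namely `planarField`. One combination of its
pairings, with coefficients affine in `t`, cancels every second derivative of `F` except the one
twice in the velocity direction `α`. Constancy of the pairings makes one side affine in `t` and the
other quadratic with leading coefficient proportional to that derivative, which must therefore
vanish. For a Finsler metric it cannot, unless `α` is the direction of motion
(`IsFinsler.hess_vel_ne_zero`). The contradiction is `IsFinsler.false_of_planar_family`. Solutions
of (a) feed it directly; the Egorov paths do so in affine parametrization, and (b) is the same
family reparametrized by `x⁰`.

For (a) the matrix `A` has a single nonzero entry, so the fundamental system reduces to linear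
algebra. In particular `φ₁₁ = 0`, so the Lagrangian is affine in `ẏ¹`. Its homogeneous form is then
linear on each half of the plane spanned by `v` and the `x¹`-axis that is cut off by `x⁰_t = 0`. A
linear function of two variables is constant along some direction, which rules out convexity of its
square. -/

namespace PathGeom

open Filter Topology

/-! ### Second derivatives along lines -/

section SecondDerivative

variable {E : Type*} [NormedAddCommGroup E] [NormedSpace ℝ E]

/-- The second derivative along a line on which the function is constant vanishes. -/
theorem fderiv_fderiv_eq_zero_of_eventually_const {g : E → ℝ} {v w : E}
    (hg : ContDiffAt ℝ 2 g v) (h : ∀ᶠ t : ℝ in 𝓝 0, g (v + t • w) = g v) :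
    fderiv ℝ (fderiv ℝ g) v w w = 0 := by
  have hline : ∀ t : ℝ, HasDerivAt (fun t : ℝ => v + t • w) w t := fun t => by
    simpa using ((hasDerivAt_id t).smul_const w).const_add v
  have htend : Tendsto (fun t : ℝ => v + t • w) (𝓝 0) (𝓝 v) := by
    have := (hline 0).continuousAt.tendsto
    simpa using this
  have hd : ∀ᶠ u in 𝓝 v, DifferentiableAt ℝ g u :=
    (hg.eventually (by simp)).mono fun u hu => hu.differentiableAt (by simp)
  have h1 : ∀ᶠ t : ℝ in 𝓝 0, fderiv ℝ g (v + t • w) w = 0 := by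
    filter_upwards [h.eventually_nhds, htend.eventually hd] with t ht hdt
    have h2 : HasDerivAt (fun t : ℝ => g (v + t • w)) (fderiv ℝ g (v + t • w) w) t :=
      hdt.hasFDerivAt.comp_hasDerivAt t (hline t)
    have h3 : HasDerivAt (fun t : ℝ => g (v + t • w)) 0 t :=
      (hasDerivAt_const t (g v)).congr_of_eventuallyEq ht
    exact h2.unique h3
  have hdd : DifferentiableAt ℝ (fderiv ℝ g) v :=
    (hg.fderiv_right (m := 1) (by norm_num)).differentiableAt (by simp)
  have h4 : HasDerivAt (fun t : ℝ => fderiv ℝ g (v + t • w) w)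
      (fderiv ℝ (fderiv ℝ g) v w w) 0 := by
    have hv : v = v + (0 : ℝ) • w := by simp
    have hc : HasDerivAt (fun t : ℝ => fderiv ℝ g (v + t • w)) (fderiv ℝ (fderiv ℝ g) v w) 0 :=
      hdd.hasFDerivAt.comp_hasDerivAt_of_eq (0 : ℝ) (hline 0) hv
    exact (ContinuousLinearMap.apply ℝ ℝ w).hasFDerivAt.comp_hasDerivAt (0 : ℝ) hc
  exact h4.unique ((hasDerivAt_const (0 : ℝ) (0 : ℝ)).congr_of_eventuallyEq h1)

end SecondDerivative

/-! ### Lagrangians of the special form are not convex -/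

/-- The ratios are homogeneous of degree zero, for negative factors as well. -/
theorem egorovForm_smul {m : ℕ} (ψ₀ ψ₁ : Crd (m + 1) → ℝ) (v : Crd (m + 3)) {c : ℝ}
    (hc : c ≠ 0) : egorovForm ψ₀ ψ₁ (c • v) = c * egorovForm ψ₀ ψ₁ v := by
  have : ratios (c • v) = ratios v := by
    funext j
    simp [ratios, mul_div_mul_left _ _ hc]
  simp only [egorovForm, this, Pi.smul_apply, smul_eq_mul]
  ring

theorem ratios_add_single_one {m : ℕ} (v : Crd (m + 3)) (s : ℝ) :
    ratios (v + Pi.single 1 s) = ratios v := by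
  funext j
  have h1 : (j.succ.succ : Fin (m + 3)) ≠ 1 := by
    intro h
    have := congrArg Fin.val h
    simp at this
  simp [ratios, h1]

/-- The ratios do not involve `v 1`, so the dependence on that coordinate is affine. -/
theorem egorovForm_add_single_one {m : ℕ} (ψ₀ ψ₁ : Crd (m + 1) → ℝ) (v : Crd (m + 3)) (s : ℝ) :
    egorovForm ψ₀ ψ₁ (v + Pi.single 1 s) = egorovForm ψ₀ ψ₁ v + ψ₁ (ratios v) * s := by
  simp only [egorovForm, ratios_add_single_one, Pi.add_apply, Pi.single_apply]
  simp
  ring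

theorem not_strictConvexOn_egorovForm_sq {m : ℕ} (ψ₀ ψ₁ : Crd (m + 1) → ℝ) :
    ¬ StrictConvexOn ℝ {v : Crd (m + 3) | 0 < v 0} (fun v => egorovForm ψ₀ ψ₁ v ^ 2) := by
  intro h
  set v : Crd (m + 3) := Pi.single 0 1 with hv
  have hv0 : v 0 = 1 := by simp [hv]
  by_cases hb : ψ₁ (ratios v) = 0
  -- With zero slope the form is constant on the line through `v` parallel to the `x¹`-axis.
  · have key := h.2 (show 0 < v 0 by simp [hv0])
      (show 0 < (v + Pi.single 1 2 : Crd (m + 3)) 0 by simp [hv0])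
      (by
        intro hne
        have := congrFun hne 1
        simp at this)
      (show (0 : ℝ) < 1 / 2 by norm_num) (show (0 : ℝ) < 1 / 2 by norm_num) (by norm_num)
    have hmid : (1 / 2 : ℝ) • v + (1 / 2 : ℝ) • (v + Pi.single 1 2) = v + Pi.single 1 1 := by
      ext i
      simp [Pi.single_apply]
      split_ifs <;> ring
    rw [hmid] at key
    simp only [egorovForm_add_single_one, hb, smul_eq_mul] at key
    linarith
  -- With nonzero slope the form has a zero `u` on that line, hence vanishes at both `u` and `2 •
  -- u`; strict convexity would make a square negative between them.
  · set s := -(egorovForm ψ₀ ψ₁ v) / ψ₁ (ratios v) with hs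
    set u := v + Pi.single 1 s with hu
    have hu0 : u 0 = 1 := by simp [hu, hv0]
    have hLu : egorovForm ψ₀ ψ₁ u = 0 := by
      rw [hu, egorovForm_add_single_one, hs]
      field_simp
      ring
    have key := h.2 (show 0 < u 0 by simp [hu0]) (show 0 < ((2 : ℝ) • u) 0 by simp [hu0])
      (by
        intro hne
        have := congrFun hne 0
        simp [hu0] at this)
      (show (0 : ℝ) < 1 / 2 by norm_num) (show (0 : ℝ) < 1 / 2 by norm_num) (by norm_num)
    simp only [egorovForm_smul ψ₀ ψ₁ u (two_ne_zero), hLu, smul_eq_mul] at key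
    nlinarith [sq_nonneg (egorovForm ψ₀ ψ₁ ((1 / 2 : ℝ) • u + (1 / 2 : ℝ) • (2 : ℝ) • u))]

theorem contDiffAt_egorovForm {m : ℕ} {ψ₀ ψ₁ : Crd (m + 1) → ℝ} {v : Crd (m + 3)}
    (hv : v 0 ≠ 0) (h₀ : ContDiffAt ℝ 2 ψ₀ (ratios v)) (h₁ : ContDiffAt ℝ 2 ψ₁ (ratios v)) :
    ContDiffAt ℝ 2 (egorovForm ψ₀ ψ₁) v := by
  have happ : ∀ i : Fin (m + 3), ContDiffAt ℝ 2 (fun u : Crd (m + 3) => u i) v := fun i =>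
    (contDiff_apply ℝ ℝ i).contDiffAt
  have hr : ContDiffAt ℝ 2 (ratios : Crd (m + 3) → Crd (m + 1)) v :=
    contDiffAt_pi.2 fun j => (happ j.succ.succ).div (happ 0) hv
  exact ((h₀.comp v hr).mul (happ 0)).add ((h₁.comp v hr).mul (happ 1))

theorem not_hessPosDef_egorovForm_sq {m : ℕ} {ψ₀ ψ₁ : Crd (m + 1) → ℝ} {v : Crd (m + 3)}
    (hv : v 0 ≠ 0) (h₀ : ContDiffAt ℝ 2 ψ₀ (ratios v)) (h₁ : ContDiffAt ℝ 2 ψ₁ (ratios v)) :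
    ¬ HessPosDef (fun u => egorovForm ψ₀ ψ₁ u ^ 2) v := by
  intro h
  have hC : ContDiffAt ℝ 2 (fun u => egorovForm ψ₀ ψ₁ u ^ 2) v :=
    (contDiffAt_egorovForm hv h₀ h₁).pow 2
  -- The direction `α v + β e₁` is chosen in the kernel of the form restricted to the plane of `v`
  -- and `e₁`, where the form is linear near `v`.
  obtain ⟨α, β, hne, hαβ⟩ : ∃ α β : ℝ, (α ≠ 0 ∨ β ≠ 0) ∧
      α * egorovForm ψ₀ ψ₁ v + β * ψ₁ (ratios v) = 0 := by
    by_cases hb : ψ₁ (ratios v) = 0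
    · exact ⟨0, 1, by simp, by simp [hb]⟩
    · exact ⟨ψ₁ (ratios v), -egorovForm ψ₀ ψ₁ v, Or.inl hb, by ring⟩
  set w : Crd (m + 3) := α • v + Pi.single 1 β with hw
  have hw0 : w ≠ 0 := by
    intro hw0
    have hα : α = 0 := by
      have := congrFun hw0 0
      simpa [hw, hv, Pi.single_apply] using this
    have hβ : β = 0 := by
      have := congrFun hw0 1
      simpa [hw, hα] using this
    simp [hα, hβ] at hne
  have hconst : ∀ᶠ t : ℝ in 𝓝 0, egorovForm ψ₀ ψ₁ (v + t • w) ^ 2 = egorovForm ψ₀ ψ₁ v ^ 2 := by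
    have hev : ∀ᶠ t : ℝ in 𝓝 0, 1 + t * α ≠ 0 := by
      have : ContinuousAt (fun t : ℝ => 1 + t * α) 0 := by fun_prop
      exact this.eventually_ne (by simp)
    filter_upwards [hev] with t ht
    have hsplit : v + t • w = (1 + t * α) • v + Pi.single 1 (t * β) := by
      ext i
      simp only [hw, Pi.add_apply, Pi.smul_apply, smul_eq_mul, Pi.single_apply]
      split_ifs <;> ring
    have hrat : ratios ((1 + t * α) • v) = ratios v := by
      funext j
      simp [ratios, mul_div_mul_left _ _ ht]
    rw [hsplit, egorovForm_add_single_one, egorovForm_smul _ _ _ ht, hrat]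
    have : (1 + t * α) * egorovForm ψ₀ ψ₁ v + ψ₁ (ratios v) * (t * β) = egorovForm ψ₀ ψ₁ v := by
      linear_combination t * hαβ
    rw [this]
  have := h w hw0
  rw [fderiv_fderiv_eq_zero_of_eventually_const hC hconst] at this
  exact lt_irrefl _ this

/-! ### The fundamental system of the linear equation -/

theorem pdVel_linearODE {m : ℕ} (i j : Fin (m + 2)) :
    pdVel i (fun z => linearODE m z j) = 0 := by
  funext z
  by_cases hj : j = 0
  · have : (fun z : Jet (m + 2) => linearODE m z j) =
        (ContinuousLinearMap.proj 1).comp ((ContinuousLinearMap.fst ℝ _ _).comp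
          (ContinuousLinearMap.snd ℝ ℝ (Crd (m + 2) × Crd (m + 2)))) := by
      funext z; simp [linearODE, hj]
    simp only [pdVel]
    rw [this, ContinuousLinearMap.fderiv]
    simp
  · simp [pdVel, linearODE, hj]

theorem pdPos_linearODE {m : ℕ} (i j : Fin (m + 2)) (z : Jet (m + 2)) :
    pdPos i (fun z => linearODE m z j) z = if j = 0 ∧ i = 1 then 1 else 0 := by
  by_cases hj : j = 0
  · have : (fun z : Jet (m + 2) => linearODE m z j) =
        (ContinuousLinearMap.proj 1).comp ((ContinuousLinearMap.fst ℝ _ _).comp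
          (ContinuousLinearMap.snd ℝ ℝ (Crd (m + 2) × Crd (m + 2)))) := by
      funext z; simp [linearODE, hj]
    simp only [pdPos]
    rw [this, ContinuousLinearMap.fderiv]
    simp [hj, Pi.single_apply, eq_comm]
  · simp [pdPos, linearODE, hj]

/-- Since `f` does not depend on the velocities, only `-2 ∂fʲ/∂yⁱ` survives. -/
theorem douglasA_linearODE {m : ℕ} (i j : Fin (m + 2)) (z : Jet (m + 2)) :
    douglasA (linearODE m) i j z = if j = 0 ∧ i = 1 then -2 else 0 := by
  simp only [douglasA, pdVel_linearODE, pdPos_linearODE, totalDeriv]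
  have : fderiv ℝ (0 : Jet (m + 2) → ℝ) z = 0 := by
    simp
  rw [this]
  split_ifs <;> simp

theorem sum_douglasA_linearODE {m : ℕ} (i : Fin (m + 2)) (z : Jet (m + 2))
    (a : Fin (m + 2) → ℝ) :
    ∑ k, douglasA (linearODE m) i k z * a k = if i = 1 then -2 * a 0 else 0 := by
  simp only [douglasA_linearODE]
  by_cases hi : i = 1 <;> simp [hi]

theorem fundamentalSystem_linearODE_iff {m : ℕ} {U : Set (Jet (m + 2))}
    {φ : Jet (m + 2) → Matrix (Fin (m + 2)) (Fin (m + 2)) ℝ} (hφ : IsMetricField U φ) :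
    FundamentalSystem (linearODE m) U φ ↔
      IsVelClosed U φ ∧
      ∀ z ∈ U, (∀ j, j ≠ 1 → φ z 0 j = 0) ∧ φ z 0 1 ≠ 0 ∧
        ∀ i j, totalDeriv (linearODE m) (fun z' => φ z' i j) z = 0 := by
  constructor
  · intro h
    refine ⟨h.closed, fun z hz => ?_⟩
    have h0 : ∀ j, j ≠ 1 → φ z 0 j = 0 := fun j hj => by
      -- Row `1` is the only nonzero row of `A`: against any other row the symmetry condition reads
      -- `-2 φ₁ⱼ = 0`, in one-based indices.
      have := h.symmetric z hz 1 j
      rw [sum_douglasA_linearODE, sum_douglasA_linearODE] at this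
      simpa [hj] using this
    refine ⟨h0, fun h1 => hφ.nondeg z hz ?_, fun i j => ?_⟩
    · refine Matrix.det_eq_zero_of_row_eq_zero 0 fun j => ?_
      by_cases hj : j = 1
      · rw [hj, h1]
      · exact h0 j hj
    · simpa [pdVel_linearODE] using h.transport z hz i j
  · rintro ⟨hc, h⟩
    refine ⟨hc, fun z hz i j => ?_, fun z hz i j => ?_⟩
    · simpa [pdVel_linearODE] using (h z hz).2.2 i j
    · rw [sum_douglasA_linearODE, sum_douglasA_linearODE]
      by_cases hi : i = 1 <;> by_cases hj : j = 1
      · simp [hi, hj]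
      · simp [hi, hj, (h z hz).1 j hj]
      · simp [hi, hj, (h z hz).1 i hi]
      · simp [hi, hj]

/-! ### The form of the Lagrangian -/

theorem contDiff_cons {k : ℕ} {E : Type*} [NormedAddCommGroup E] [NormedSpace ℝ E]
    {f : E → ℝ} {g : E → Crd k} (hf : ContDiff ℝ ∞ f) (hg : ContDiff ℝ ∞ g) :
    ContDiff ℝ ∞ (fun z => (Fin.cons (f z) (g z) : Crd (k + 1))) := by
  refine contDiff_pi.2 fun i => ?_
  refine Fin.cases ?_ (fun j => ?_) i
  · simpa using hf
  · simpa using contDiff_pi.1 hg j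

theorem contDiff_tail {k : ℕ} : ContDiff ℝ ∞ (Fin.tail : Crd (k + 1) → Crd k) :=
  contDiff_pi.2 fun j => contDiff_apply ℝ ℝ j.succ

/-- The jet with position `X` and velocities `s, p`. -/
def jetOf {k : ℕ} (s : ℝ) (X : Crd (k + 2)) (p : Crd k) : Jet (k + 1) :=
  (X 0, Fin.tail X, Fin.cons s p)

theorem contDiff_jetOf {k : ℕ} :
    ContDiff ℝ ∞ (fun q : ℝ × Crd (k + 2) × Crd k => jetOf q.1 q.2.1 q.2.2) :=
  ContDiff.prodMk ((contDiff_apply ℝ ℝ 0).comp (contDiff_fst.comp contDiff_snd))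
    ((contDiff_tail.comp (contDiff_fst.comp contDiff_snd)).prodMk
      (contDiff_cons contDiff_fst (contDiff_snd.comp contDiff_snd)))

theorem contDiffOn_dehomogenize {n : ℕ} {U : Set (Jet n)} {Lhat : Crd (n + 1) → Crd (n + 1) → ℝ}
    (hL : ContDiffOn ℝ ∞ (fun q : Crd (n + 1) × Crd (n + 1) => Lhat q.1 q.2) (coneOver U)) :
    ContDiffOn ℝ ∞ (dehomogenize Lhat) U := by
  have h1 : ContDiff ℝ ∞ (fun z : Jet n =>
      ((Fin.cons z.1 z.2.1, Fin.cons 1 z.2.2) : Crd (n + 1) × Crd (n + 1))) :=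
    (contDiff_cons contDiff_fst (contDiff_fst.comp contDiff_snd)).prodMk
      (contDiff_cons contDiff_const (contDiff_snd.comp contDiff_snd))
  refine hL.comp h1.contDiffOn fun z hz => ?_
  simpa [coneOver] using hz

theorem contDiffOn_pdVel {n : ℕ} {U : Set (Jet n)} (hU : IsOpen U) {g : Jet n → ℝ}
    (hg : ContDiffOn ℝ ∞ g U) (i : Fin n) : ContDiffOn ℝ ∞ (pdVel i g) U :=
  (hg.fderiv_of_isOpen hU (m := ∞) (by simp)).clm_apply contDiffOn_const

theorem hasDerivAt_jetOf {k : ℕ} {g : Jet (k + 1) → ℝ} {s : ℝ} {X : Crd (k + 2)} {p : Crd k}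
    (hg : DifferentiableAt ℝ g (jetOf s X p)) :
    HasDerivAt (fun s => g (jetOf s X p)) (pdVel 0 g (jetOf s X p)) s := by
  have h1 : HasDerivAt (fun s => jetOf s X p) ((0, 0, Pi.single 0 1) : Jet (k + 1)) s := by
    refine (hasDerivAt_const s _).prodMk ((hasDerivAt_const s _).prodMk (hasDerivAt_pi.2 ?_))
    intro i
    refine Fin.cases ?_ (fun j => ?_) i
    · simpa using hasDerivAt_id' s
    · simpa using hasDerivAt_const s (p j)
  exact hg.hasFDerivAt.comp_hasDerivAt s h1

/-- A function whose second derivative in the first velocity vanishes is affine on the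
intervals in which lines parallel to that axis meet its domain. -/
theorem pdVel_eq_and_sub_eq {k : ℕ} {U : Set (Jet (k + 1))} (hU : IsOpen U)
    {L : Jet (k + 1) → ℝ} (hL : ContDiffOn ℝ ∞ L U)
    (h0 : ∀ z ∈ U, pdVel 0 (pdVel 0 L) z = 0) {X : Crd (k + 2)} {p : Crd k}
    (hconn : OrdConnected {s : ℝ | jetOf s X p ∈ U}) {s t : ℝ}
    (hs : jetOf s X p ∈ U) (ht : jetOf t X p ∈ U) :
    pdVel 0 L (jetOf s X p) = pdVel 0 L (jetOf t X p) ∧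
      L (jetOf s X p) - s * pdVel 0 L (jetOf s X p) =
        L (jetOf t X p) - t * pdVel 0 L (jetOf t X p) := by
  have hcont : Continuous fun s => jetOf s X p :=
    contDiff_jetOf.continuous.comp (by fun_prop : Continuous fun s : ℝ => (s, X, p))
  have hopen : IsOpen {s : ℝ | jetOf s X p ∈ U} := hU.preimage hcont
  have hd1 : ∀ r ∈ {s : ℝ | jetOf s X p ∈ U},
      HasDerivAt (fun s => pdVel 0 L (jetOf s X p)) 0 r := fun r hr => by
    have := hasDerivAt_jetOf (((contDiffOn_pdVel hU hL 0).contDiffAt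
      (hU.mem_nhds hr)).differentiableAt (by simp))
    rwa [h0 _ hr] at this
  have hd0 : ∀ r ∈ {s : ℝ | jetOf s X p ∈ U},
      HasDerivAt (fun s => L (jetOf s X p) - s * pdVel 0 L (jetOf s X p)) 0 r := fun r hr => by
    have h := (hasDerivAt_jetOf ((hL.contDiffAt (hU.mem_nhds hr)).differentiableAt
      (by simp))).sub ((hasDerivAt_id' r).mul (hd1 r hr))
    exact h.congr_deriv (by simp)
  exact ⟨hopen.is_const_of_deriv_eq_zero hconn.isPreconnected
      (fun r hr => (hd1 r hr).differentiableAt.differentiableWithinAt)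
      (fun r hr => (hd1 r hr).deriv) hs ht,
    hopen.is_const_of_deriv_eq_zero hconn.isPreconnected
      (fun r hr => (hd0 r hr).differentiableAt.differentiableWithinAt)
      (fun r hr => (hd0 r hr).deriv) hs ht⟩

theorem jetOf_mem_of_mem_coneOver {m : ℕ} {U : Set (Jet (m + 2))} {q : Crd (m + 3) × Crd (m + 3)}
    (hq : q ∈ coneOver U) : jetOf (q.2 1 / q.2 0) q.1 (ratios q.2) ∈ U := by
  have : (Fin.cons (q.2 1 / q.2 0) (ratios q.2) : Crd (m + 2)) =
      fun j : Fin (m + 2) => q.2 j.succ / q.2 0 := by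
    funext j
    refine Fin.cases ?_ (fun i => ?_) j
    · simp
    · simp [ratios]
  rw [jetOf, this]
  exact hq.2

/-- Homogeneity applied with the factor `1 / x⁰_t` recovers the homogeneous Lagrangian from its
values at `x⁰_t = 1`. -/
theorem eq_mul_dehomogenize {m : ℕ} {U : Set (Jet (m + 2))}
    {Lhat : Crd (m + 3) → Crd (m + 3) → ℝ}
    (hhom : ∀ q ∈ coneOver U, ∀ c : ℝ, 0 < c → Lhat q.1 (c • q.2) = c * Lhat q.1 q.2)
    {q : Crd (m + 3) × Crd (m + 3)} (hq : q ∈ coneOver U) :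
    Lhat q.1 q.2 = q.2 0 * dehomogenize Lhat (jetOf (q.2 1 / q.2 0) q.1 (ratios q.2)) := by
  have hpos : 0 < q.2 0 := hq.1
  have h := hhom q hq (q.2 0)⁻¹ (inv_pos.2 hpos)
  have h1 : (Fin.cons 1 (Fin.cons (q.2 1 / q.2 0) (ratios q.2)) : Crd (m + 3)) =
      (q.2 0)⁻¹ • q.2 := by
    funext j
    refine Fin.cases ?_ (fun i => Fin.cases ?_ (fun l => ?_) i) j
    · simp [hpos.ne']
    · simp [div_eq_inv_mul]
    · simp [ratios, div_eq_inv_mul]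
  simp only [dehomogenize, jetOf, h1, Fin.cons_self_tail, h]
  field_simp

/-- On each line parallel to the `ẏ¹`-axis `L` is affine, so `ψ₁` is its slope and `ψ₀` its
intercept. Both can be read off at any point of the line in `U`; near a given line a fixed value of
`ẏ¹` serves, whence smoothness. -/
theorem exists_egorovForm {m : ℕ} {U : Set (Jet (m + 2))} {Lhat : Crd (m + 3) → Crd (m + 3) → ℝ}
    (hU : IsOpen U)
    (hconn : ∀ (x : ℝ) (y : Crd (m + 2)) (p : Crd (m + 1)),
      Set.OrdConnected {s : ℝ | (x, y, (Fin.cons s p : Crd (m + 2))) ∈ U})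
    (hL : ContDiffOn ℝ ∞ (fun q : Crd (m + 3) × Crd (m + 3) => Lhat q.1 q.2) (coneOver U))
    (hhom : ∀ q ∈ coneOver U, ∀ c : ℝ, 0 < c → Lhat q.1 (c • q.2) = c * Lhat q.1 q.2)
    (h0 : ∀ z ∈ U, velHessian (dehomogenize Lhat) z 0 0 = 0) :
    ∃ ψ₀ ψ₁ : Crd (m + 3) → Crd (m + 1) → ℝ,
      ContDiffOn ℝ ∞ (fun r : Crd (m + 3) × Crd (m + 1) => ψ₀ r.1 r.2)
        ((fun q : Crd (m + 3) × Crd (m + 3) => (q.1, ratios q.2)) '' coneOver U) ∧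
      ContDiffOn ℝ ∞ (fun r : Crd (m + 3) × Crd (m + 1) => ψ₁ r.1 r.2)
        ((fun q : Crd (m + 3) × Crd (m + 3) => (q.1, ratios q.2)) '' coneOver U) ∧
      ∀ q ∈ coneOver U, Lhat q.1 q.2 = egorovForm (ψ₀ q.1) (ψ₁ q.1) q.2 := by
  classical
  set L := dehomogenize Lhat with hLdef
  have hLU : ContDiffOn ℝ ∞ L U := contDiffOn_dehomogenize hL
  have hL1 := contDiffOn_pdVel hU hLU 0
  have h00 : ∀ z ∈ U, pdVel 0 (pdVel 0 L) z = 0 := h0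
  -- An arbitrary, possibly discontinuous choice of a point on each line; the value `0` is used only
  -- for lines that miss `U`.
  let sel : Crd (m + 3) → Crd (m + 1) → ℝ := fun X p =>
    if h : ∃ s, jetOf s X p ∈ U then h.choose else 0
  have hsel : ∀ {X p s}, jetOf s X p ∈ U → jetOf (sel X p) X p ∈ U := fun {X p s} hs => by
    have h : ∃ s, jetOf s X p ∈ U := ⟨s, hs⟩
    simp only [sel, dif_pos h]
    exact h.choose_spec
  let ψ₁ : Crd (m + 3) → Crd (m + 1) → ℝ := fun X p => pdVel 0 L (jetOf (sel X p) X p)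
  let ψ₀ : Crd (m + 3) → Crd (m + 1) → ℝ := fun X p =>
    L (jetOf (sel X p) X p) - sel X p * pdVel 0 L (jetOf (sel X p) X p)
  have hψ : ∀ {X p s}, jetOf s X p ∈ U → ψ₁ X p = pdVel 0 L (jetOf s X p) ∧
      ψ₀ X p = L (jetOf s X p) - s * pdVel 0 L (jetOf s X p) := fun {X p s} hs =>
    pdVel_eq_and_sub_eq hU hLU h00 (hconn (X 0) (Fin.tail X) p) (hsel hs) hs
  have hslice : ∀ s : ℝ, ContDiff ℝ ∞
      (fun r : Crd (m + 3) × Crd (m + 1) => jetOf s r.1 r.2) := fun s =>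
    contDiff_jetOf.comp (contDiff_const.prodMk contDiff_id)
  have hnear : ∀ r ∈ (fun q : Crd (m + 3) × Crd (m + 3) => (q.1, ratios q.2)) '' coneOver U,
      ∃ s, jetOf s r.1 r.2 ∈ U ∧ ∀ᶠ r' in 𝓝 r, jetOf s r'.1 r'.2 ∈ U := by
    rintro _ ⟨q, hq, rfl⟩
    exact ⟨_, jetOf_mem_of_mem_coneOver hq,
      (hslice _).continuous.continuousAt.eventually (hU.mem_nhds (jetOf_mem_of_mem_coneOver hq))⟩
  refine ⟨ψ₀, ψ₁, fun r hr => ?_, fun r hr => ?_, fun q hq => ?_⟩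
  · obtain ⟨s, hs, hev⟩ := hnear r hr
    have h1 : ContDiffAt ℝ ∞ (fun r : Crd (m + 3) × Crd (m + 1) =>
        L (jetOf s r.1 r.2) - s * pdVel 0 L (jetOf s r.1 r.2)) r :=
      ((hLU.contDiffAt (hU.mem_nhds hs)).comp r (hslice s).contDiffAt).sub
        (contDiffAt_const.mul ((hL1.contDiffAt (hU.mem_nhds hs)).comp r (hslice s).contDiffAt))
    exact (h1.congr_of_eventuallyEq (hev.mono fun r' h => (hψ h).2)).contDiffWithinAt
  · obtain ⟨s, hs, hev⟩ := hnear r hr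
    have h1 : ContDiffAt ℝ ∞ (fun r : Crd (m + 3) × Crd (m + 1) =>
        pdVel 0 L (jetOf s r.1 r.2)) r :=
      ContDiffAt.comp (g := pdVel 0 L) r (hL1.contDiffAt (hU.mem_nhds hs))
        (hslice s).contDiffAt
    exact (h1.congr_of_eventuallyEq (hev.mono fun r' h => (hψ h).1)).contDiffWithinAt
  · obtain ⟨h1, h2⟩ := hψ (jetOf_mem_of_mem_coneOver hq)
    have hpos : q.2 0 ≠ 0 := ne_of_gt hq.1
    rw [eq_mul_dehomogenize hhom hq, egorovForm, h1, h2]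
    field_simp
    ring

/-! ### Conservation of the symplectic form along a family of extremals -/

section Symplectic

variable {E : Type*} [NormedAddCommGroup E] [NormedSpace ℝ E]

theorem fderiv_fderiv_comm {V : Type*} [NormedAddCommGroup V] [NormedSpace ℝ V] {f : E → V}
    {x : E} (hf : ContDiffAt ℝ ∞ f x) (v w : E) :
    fderiv ℝ (fderiv ℝ f) x v w = fderiv ℝ (fderiv ℝ f) x w v := by
  have h2 : ((2 : ℕ) : ℕ∞) ≤ ⊤ := le_top
  have h : minSmoothness ℝ 2 ≤ ∞ := by
    rw [minSmoothness_of_isRCLikeNormedField]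
    exact WithTop.coe_le_coe.2 h2
  exact hf.isSymmSndFDerivAt h v w

/-- The linearization of the Euler-Lagrange equations, at the jet `z` with derivative `z'`, in
the direction `j` with derivative `j'`. -/
theorem linearized_eulerLagrange {G : E × E → ℝ} {z z' j j' : E × E} {w : E}
    (hG : ContDiffAt ℝ ∞ G z)
    (h : ∀ᶠ a : ℝ in 𝓝 0, fderiv ℝ (fderiv ℝ G) (z + a • j) (z' + a • j') (0, w) =
      fderiv ℝ G (z + a • j) (w, 0)) :
    fderiv ℝ (fderiv ℝ (fderiv ℝ G)) z j z' (0, w) + fderiv ℝ (fderiv ℝ G) z j' (0, w) =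
      fderiv ℝ (fderiv ℝ G) z j (w, 0) := by
  have hG1 : ContDiffAt ℝ ∞ (fderiv ℝ G) z := hG.fderiv_right (by simp)
  have hG2 : ContDiffAt ℝ ∞ (fderiv ℝ (fderiv ℝ G)) z := hG1.fderiv_right (by simp)
  have hl : ∀ (u u' : E × E), HasDerivAt (fun a : ℝ => u + a • u') u' 0 := fun u u' => by
    simpa using ((hasDerivAt_id' (0 : ℝ)).smul_const u').const_add u
  have hz : z = z + (0 : ℝ) • j := by simp
  have h1 : HasDerivAt (fun a : ℝ => fderiv ℝ G (z + a • j)) (fderiv ℝ (fderiv ℝ G) z j) 0 :=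
    (hG1.differentiableAt (by simp)).hasFDerivAt.comp_hasDerivAt_of_eq (0 : ℝ) (hl z j) hz
  have h2 : HasDerivAt (fun a : ℝ => fderiv ℝ (fderiv ℝ G) (z + a • j))
      (fderiv ℝ (fderiv ℝ (fderiv ℝ G)) z j) 0 :=
    (hG2.differentiableAt (by simp)).hasFDerivAt.comp_hasDerivAt_of_eq (0 : ℝ) (hl z j) hz
  have h3 : HasDerivAt (fun a : ℝ => fderiv ℝ G (z + a • j) (w, 0))
      (fderiv ℝ (fderiv ℝ G) z j (w, 0)) 0 :=
    (ContinuousLinearMap.apply ℝ ℝ (w, (0 : E))).hasFDerivAt.comp_hasDerivAt (0 : ℝ) h1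
  have h4 : HasDerivAt (fun a : ℝ => fderiv ℝ (fderiv ℝ G) (z + a • j) (z' + a • j'))
      (fderiv ℝ (fderiv ℝ (fderiv ℝ G)) z j z' + fderiv ℝ (fderiv ℝ G) z j') 0 :=
    (h2.clm_apply (hl z' j')).congr_deriv (by simp)
  have h5 : HasDerivAt (fun a : ℝ => fderiv ℝ (fderiv ℝ G) (z + a • j) (z' + a • j') (0, w))
      ((fderiv ℝ (fderiv ℝ (fderiv ℝ G)) z j z' + fderiv ℝ (fderiv ℝ G) z j') (0, w)) 0 :=
    (ContinuousLinearMap.apply ℝ ℝ ((0 : E), w)).hasFDerivAt.comp_hasDerivAt (0 : ℝ) h4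
  exact h5.unique (h3.congr_of_eventuallyEq h)

/-- The symplectic form of the Lagrangian `G` on two fields along the curve `c`. -/
noncomputable def symplecticPairing (G : E × E → ℝ) (c J K : ℝ → E) (t : ℝ) : ℝ :=
  fderiv ℝ (fderiv ℝ G) (c t, deriv c t) (J t, deriv J t) (0, K t) -
    fderiv ℝ (fderiv ℝ G) (c t, deriv c t) (K t, deriv K t) (0, J t)

theorem hasDerivAt_jet {c : ℝ → E} (hc : ContDiff ℝ ∞ c) (t : ℝ) :
    HasDerivAt (fun s => (c s, deriv c s)) (deriv c t, deriv (deriv c) t) t :=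
  (hc.differentiable (by simp) t).hasDerivAt.prodMk
    ((contDiff_infty_iff_deriv.1 hc).2.differentiable (by simp) t).hasDerivAt

/-- The linearized Euler-Lagrange equation for `J` eliminates the third derivatives of `G`. What
remains is the second derivative of `G` on the jets of `J` and `K`, which is symmetric in the two
fields. -/
theorem hasDerivAt_momentum {G : E × E → ℝ} {c J K : ℝ → E} {t : ℝ}
    (hc : ContDiff ℝ ∞ c) (hJ : ContDiff ℝ ∞ J) (hK : ContDiff ℝ ∞ K)
    (hG : ContDiffAt ℝ ∞ G (c t, deriv c t))
    (h : ∀ w, ∀ᶠ a : ℝ in 𝓝 0,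
      fderiv ℝ (fderiv ℝ G) ((c t, deriv c t) + a • (J t, deriv J t))
        ((deriv c t, deriv (deriv c) t) + a • (deriv J t, deriv (deriv J) t)) (0, w) =
      fderiv ℝ G ((c t, deriv c t) + a • (J t, deriv J t)) (w, 0)) :
    HasDerivAt (fun s => fderiv ℝ (fderiv ℝ G) (c s, deriv c s) (J s, deriv J s) (0, K s))
      (fderiv ℝ (fderiv ℝ G) (c t, deriv c t) (J t, deriv J t) (K t, deriv K t)) t := by
  have hG1 : ContDiffAt ℝ ∞ (fderiv ℝ G) (c t, deriv c t) := hG.fderiv_right (by simp)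
  have hG2 : ContDiffAt ℝ ∞ (fderiv ℝ (fderiv ℝ G)) (c t, deriv c t) :=
    hG1.fderiv_right (by simp)
  have h1 : HasDerivAt (fun s => fderiv ℝ (fderiv ℝ G) (c s, deriv c s))
      (fderiv ℝ (fderiv ℝ (fderiv ℝ G)) (c t, deriv c t) (deriv c t, deriv (deriv c) t)) t :=
    HasFDerivAt.comp_hasDerivAt (f := fun s => (c s, deriv c s)) t
      (hG2.differentiableAt (by simp)).hasFDerivAt (hasDerivAt_jet hc t)
  have h2 := h1.clm_apply (hasDerivAt_jet hJ t)
  have h3 : HasDerivAt (fun s => ((0 : E), K s)) (0, deriv K t) t :=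
    (hasDerivAt_const t 0).prodMk (hK.differentiable (by simp) t).hasDerivAt
  refine (h2.clm_apply h3).congr_deriv ?_
  have hsymm : fderiv ℝ (fderiv ℝ (fderiv ℝ G)) (c t, deriv c t) (deriv c t, deriv (deriv c) t)
      (J t, deriv J t) = fderiv ℝ (fderiv ℝ (fderiv ℝ G)) (c t, deriv c t) (J t, deriv J t)
        (deriv c t, deriv (deriv c) t) :=
    fderiv_fderiv_comm hG1 _ _
  have hlin := linearized_eulerLagrange hG (h (K t))
  have hsplit : ((K t, deriv K t) : E × E) = (K t, 0) + (0, deriv K t) := by simp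
  rw [hsymm, hsplit, map_add, ← hlin]
  simp

/-- The two momentum terms have equal derivatives by symmetry of the second derivative. -/
theorem hasDerivAt_symplecticPairing {G : E × E → ℝ} {c J K : ℝ → E} {t : ℝ}
    (hc : ContDiff ℝ ∞ c) (hJ : ContDiff ℝ ∞ J) (hK : ContDiff ℝ ∞ K)
    (hG : ContDiffAt ℝ ∞ G (c t, deriv c t))
    (h : ∀ A ∈ ({J, K} : Set (ℝ → E)), ∀ w, ∀ᶠ a : ℝ in 𝓝 0,
      fderiv ℝ (fderiv ℝ G) ((c t, deriv c t) + a • (A t, deriv A t))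
        ((deriv c t, deriv (deriv c) t) + a • (deriv A t, deriv (deriv A) t)) (0, w) =
      fderiv ℝ G ((c t, deriv c t) + a • (A t, deriv A t)) (w, 0)) :
    HasDerivAt (symplecticPairing G c J K) 0 t := by
  refine ((hasDerivAt_momentum hc hJ hK hG (h J (by simp))).sub
    (hasDerivAt_momentum hc hK hJ hG (h K (by simp)))).congr_deriv ?_
  rw [fderiv_fderiv_comm hG (K t, deriv K t) (J t, deriv J t), sub_self]

end Symplectic

/-! ### Extremals of Finsler metrics -/

section Finsler

variable {k : ℕ} {W : Set (Crd k)} {F : Crd k → Crd k → ℝ}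

/-- The Euler-Lagrange equations at one point of a curve. -/
def IsExtremalAt (F : Crd k → Crd k → ℝ) (c : ℝ → Crd k) (t : ℝ) : Prop :=
  ∀ i : Fin k, HasDerivAt (fun s => pd i (F (c s)) (deriv c s))
    (pd i (fun x => F x (deriv c t)) (c t)) t

theorem IsFinsler.contDiffAt (hF : IsFinsler W F) (hW : IsOpen W) {x v : Crd k} (hx : x ∈ W)
    (hv : v ≠ 0) : ContDiffAt ℝ ∞ (fun q : Crd k × Crd k => F q.1 q.2) (x, v) :=
  hF.smooth.contDiffAt ((hW.prod isOpen_ne).mem_nhds ⟨hx, hv⟩)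

theorem IsFinsler.hasFDerivAt_vel (hF : IsFinsler W F) (hW : IsOpen W) {x v : Crd k} (hx : x ∈ W)
    (hv : v ≠ 0) : HasFDerivAt (F x) ((fderiv ℝ (fun q : Crd k × Crd k => F q.1 q.2) (x, v)).comp
      (ContinuousLinearMap.inr ℝ (Crd k) (Crd k))) v :=
  HasFDerivAt.comp (g := fun q : Crd k × Crd k => F q.1 q.2) v
    ((hF.contDiffAt hW hx hv).differentiableAt (by simp)).hasFDerivAt (hasFDerivAt_prodMk_right x v)

theorem IsFinsler.pd_vel (hF : IsFinsler W F) (hW : IsOpen W) {x v : Crd k} (hx : x ∈ W)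
    (hv : v ≠ 0) (i : Fin k) : pd i (F x) v =
      fderiv ℝ (fun q : Crd k × Crd k => F q.1 q.2) (x, v) (0, Pi.single i 1) := by
  rw [pd, (hF.hasFDerivAt_vel hW hx hv).fderiv]
  simp

theorem IsFinsler.pd_pos (hF : IsFinsler W F) (hW : IsOpen W) {x v : Crd k} (hx : x ∈ W)
    (hv : v ≠ 0) (i : Fin k) : pd i (fun y => F y v) x =
      fderiv ℝ (fun q : Crd k × Crd k => F q.1 q.2) (x, v) (Pi.single i 1, 0) := by
  have : HasFDerivAt (fun y => F y v)
      ((fderiv ℝ (fun q : Crd k × Crd k => F q.1 q.2) (x, v)).comp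
        (ContinuousLinearMap.inl ℝ (Crd k) (Crd k))) x :=
    HasFDerivAt.comp (g := fun q : Crd k × Crd k => F q.1 q.2) (f := fun y => (y, v)) x
      ((hF.contDiffAt hW hx hv).differentiableAt (by simp)).hasFDerivAt
      (hasFDerivAt_prodMk_left x v)
  rw [pd, this.fderiv]
  simp

/-- The chain rule turns the equations into an identity in the 2-jet of the curve at one time, free
of coordinates, which can then be differentiated in a parameter. -/
theorem IsExtremalAt.eulerLagrange (hF : IsFinsler W F) (hW : IsOpen W) {c : ℝ → Crd k} {t : ℝ}
    (hc : ContDiff ℝ ∞ c) (hcW : c t ∈ W) (hreg : deriv c t ≠ 0) (h : IsExtremalAt F c t)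
    (w : Crd k) :
    fderiv ℝ (fderiv ℝ fun q : Crd k × Crd k => F q.1 q.2) (c t, deriv c t)
        (deriv c t, deriv (deriv c) t) (0, w) =
      fderiv ℝ (fun q : Crd k × Crd k => F q.1 q.2) (c t, deriv c t) (w, 0) := by
  set G : Crd k × Crd k → ℝ := fun q => F q.1 q.2 with hGdef
  have hG : ContDiffAt ℝ ∞ G (c t, deriv c t) := hF.contDiffAt hW hcW hreg
  have hG1 : ContDiffAt ℝ ∞ (fderiv ℝ G) (c t, deriv c t) := hG.fderiv_right (by simp)
  have h1 : HasDerivAt (fun s => fderiv ℝ G (c s, deriv c s))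
      (fderiv ℝ (fderiv ℝ G) (c t, deriv c t) (deriv c t, deriv (deriv c) t)) t :=
    (hG1.differentiableAt (by simp)).hasFDerivAt.comp_hasDerivAt t (hasDerivAt_jet hc t)
  have hnear : ∀ᶠ s in 𝓝 t, c s ∈ W ∧ deriv c s ≠ 0 :=
    (hc.continuous.continuousAt.eventually (hW.mem_nhds hcW)).and
      ((contDiff_infty_iff_deriv.1 hc).2.continuous.continuousAt.eventually_ne hreg)
  have hbasis : ∀ i : Fin k, fderiv ℝ (fderiv ℝ G) (c t, deriv c t)
      (deriv c t, deriv (deriv c) t) (0, Pi.single i 1) =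
        fderiv ℝ G (c t, deriv c t) (Pi.single i 1, 0) := fun i => by
    have h2 : HasDerivAt (fun s => fderiv ℝ G (c s, deriv c s) (0, Pi.single i 1))
        (fderiv ℝ (fderiv ℝ G) (c t, deriv c t) (deriv c t, deriv (deriv c) t)
          (0, Pi.single i 1)) t :=
      (ContinuousLinearMap.apply ℝ ℝ ((0, Pi.single i 1) : Crd k × Crd k)).hasFDerivAt.comp_hasDerivAt
        t h1
    have h3 := h i
    rw [hF.pd_pos hW hcW hreg] at h3
    refine h2.unique (h3.congr_of_eventuallyEq (hnear.mono fun s hs => ?_))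
    exact (hF.pd_vel hW hs.1 hs.2 i).symm
  have hlin : ((fderiv ℝ (fderiv ℝ G) (c t, deriv c t)
      (deriv c t, deriv (deriv c) t)).comp (ContinuousLinearMap.inr ℝ (Crd k) (Crd k))).toLinearMap =
      ((fderiv ℝ G (c t, deriv c t)).comp
        (ContinuousLinearMap.inl ℝ (Crd k) (Crd k))).toLinearMap := by
    refine (Pi.basisFun ℝ (Fin k)).ext fun i => ?_
    simpa using hbasis i
  simpa using LinearMap.congr_fun hlin w

/-- The velocity Hessian of a Finsler metric is positive off the direction of the velocity. -/
theorem IsFinsler.hess_vel_ne_zero (hF : IsFinsler W F) (hW : IsOpen W) {x v e : Crd k}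
    (hx : x ∈ W) (hv : v ≠ 0) (he : ∀ a : ℝ, e ≠ a • v) :
    fderiv ℝ (fderiv ℝ fun q : Crd k × Crd k => F q.1 q.2) (x, v) (0, e) (0, e) ≠ 0 := by
  intro h0
  have hg : ∀ u, u ≠ 0 → ContDiffAt ℝ ∞ (F x) u := fun u hu =>
    ContDiffAt.comp (g := fun q : Crd k × Crd k => F q.1 q.2) u (hF.contDiffAt hW hx hu)
      (contDiffAt_const.prodMk contDiffAt_id)
  have hd : ∀ u, u ≠ 0 → HasFDerivAt (F x) (fderiv ℝ (F x) u) u := fun u hu =>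
    ((hg u hu).differentiableAt (by simp)).hasFDerivAt
  have hdd : HasFDerivAt (fderiv ℝ (F x)) (fderiv ℝ (fderiv ℝ (F x)) v) v :=
    (((hg v hv).fderiv_right (m := ∞) (by simp)).differentiableAt (by simp)).hasFDerivAt
  have hne : ∀ᶠ u in 𝓝 v, u ≠ 0 := isOpen_ne.mem_nhds hv
  -- Euler's relation and its derivative
  have heuler : ∀ u, u ≠ 0 → fderiv ℝ (F x) u u = F x u := fun u hu => by
    have h1 : HasDerivAt (fun a : ℝ => F x (a • u)) (fderiv ℝ (F x) u u) 1 := by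
      have hl : HasDerivAt (fun a : ℝ => a • u) u 1 := by
        simpa using (hasDerivAt_id' (1 : ℝ)).smul_const u
      exact (hd u hu).comp_hasDerivAt_of_eq (1 : ℝ) hl (by simp)
    have h2 : HasDerivAt (fun a : ℝ => a * F x u) (F x u) 1 := by
      simpa using (hasDerivAt_id' (1 : ℝ)).mul_const (F x u)
    refine h1.unique (h2.congr_of_eventuallyEq ?_)
    filter_upwards [lt_mem_nhds (zero_lt_one (α := ℝ))] with a ha
    exact hF.homog x hx u hu a ha
  have hrad : ∀ w, fderiv ℝ (fderiv ℝ (F x)) v w v = 0 := fun w => by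
    have h1 : HasFDerivAt (fun u => fderiv ℝ (F x) u u) _ v := hdd.clm_apply (hasFDerivAt_id v)
    have h2 := h1.unique ((hd v hv).congr_of_eventuallyEq (hne.mono fun u hu => heuler u hu))
    have := congrArg (fun A : Crd k →L[ℝ] ℝ => A w) h2
    simpa using this
  have hrad' : ∀ w, fderiv ℝ (fderiv ℝ (F x)) v v w = 0 := fun w => by
    rw [fderiv_fderiv_comm (hg v hv) v w, hrad w]
  have hee : fderiv ℝ (fderiv ℝ (F x)) v e e = 0 := by
    have hev : fderiv ℝ (F x) =ᶠ[𝓝 v] fun u =>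
        (fderiv ℝ (fun q : Crd k × Crd k => F q.1 q.2) (x, u)).comp
          (ContinuousLinearMap.inr ℝ (Crd k) (Crd k)) :=
      hne.mono fun u hu => (hF.hasFDerivAt_vel hW hx hu).fderiv
    have hG1 : DifferentiableAt ℝ (fderiv ℝ fun q : Crd k × Crd k => F q.1 q.2) (x, v) :=
      ((hF.contDiffAt hW hx hv).fderiv_right (m := ∞) (by simp)).differentiableAt (by simp)
    have h1 : HasFDerivAt (fun u => fderiv ℝ (fun q : Crd k × Crd k => F q.1 q.2) (x, u))
        ((fderiv ℝ (fderiv ℝ fun q : Crd k × Crd k => F q.1 q.2) (x, v)).comp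
          (ContinuousLinearMap.inr ℝ (Crd k) (Crd k))) v :=
      hG1.hasFDerivAt.comp v (hasFDerivAt_prodMk_right x v)
    have h2 := (h1.clm_comp (hasFDerivAt_const
      (ContinuousLinearMap.inr ℝ (Crd k) (Crd k)) v)).congr_of_eventuallyEq hev
    rw [h2.fderiv]
    simpa using h0
  -- the Hessian of the square in the direction of `e` made tangent to the indicatrix
  have hpos := hF.pos x hx v hv
  set a := fderiv ℝ (F x) v e / F x v with ha
  set w := e - a • v with hw
  have hw0 : w ≠ 0 := fun h => he a (sub_eq_zero.1 h)
  have hconv := hF.convex x hx v hv w hw0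
  have hsq : fderiv ℝ (fun u => F x u ^ 2) =ᶠ[𝓝 v] fun u => (2 * F x u) • fderiv ℝ (F x) u :=
    hne.mono fun u hu => by
      have := ((hd u hu).pow 2).fderiv
      simpa using this
  have hsq' : HasFDerivAt (fderiv ℝ (fun u => F x u ^ 2)) _ v :=
    (((hd v hv).const_mul 2).smul hdd).congr_of_eventuallyEq hsq
  rw [hsq'.fderiv] at hconv
  have hw1 : fderiv ℝ (F x) v w = 0 := by
    rw [hw, map_sub, map_smul, heuler v hv, ha, smul_eq_mul]
    field_simp
    ring
  -- The radial direction lies in the kernel of the Hessian of `F`, so subtracting `a • v` from `e`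
  -- changes nothing.
  have hw2 : fderiv ℝ (fderiv ℝ (F x)) v w w = 0 := by
    simp [hw, hee, hrad, hrad']
  simp [hw1, hw2] at hconv

end Finsler

/-! ### Cubic curves -/

/-- The curve `A + s B + s² C + s³ D`. -/
def cubicCurve {k : ℕ} (A B C D : Crd k) (s : ℝ) : Crd k :=
  fun i => A i + B i * s + C i * s ^ 2 + D i * s ^ 3

theorem contDiff_cubicCurve {k : ℕ} (A B C D : Crd k) : ContDiff ℝ ∞ (cubicCurve A B C D) := by
  refine contDiff_pi.2 fun i => ?_
  unfold cubicCurve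
  fun_prop

theorem deriv_cubicCurve {k : ℕ} (A B C D : Crd k) :
    deriv (cubicCurve A B C D) = cubicCurve B ((2 : ℝ) • C) ((3 : ℝ) • D) 0 := by
  funext s
  refine HasDerivAt.deriv (hasDerivAt_pi.2 fun i => ?_)
  have h1 := (hasDerivAt_id' s).const_mul (B i)
  have h2 := ((hasDerivAt_id' s).pow 2).const_mul (C i)
  have h3 := ((hasDerivAt_id' s).pow 3).const_mul (D i)
  refine (((h1.const_add (A i)).add h2).add h3).congr_deriv ?_
  simp [cubicCurve]
  ring

theorem cubicCurve_add_smul {k : ℕ} (A B C D A' B' C' D' : Crd k) (a s : ℝ) :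
    cubicCurve A B C D s + a • cubicCurve A' B' C' D' s =
      cubicCurve (A + a • A') (B + a • B') (C + a • C') (D + a • D') s := by
  ext i
  simp [cubicCurve]
  ring

/-- The field `(e + f s + c κ s² + d (ρ s² + σ s³)) e_α + (c + d s) e_β`. -/
def planarField {k : ℕ} (α β : Fin k) (κ ρ σ e f c d : ℝ) : ℝ → Crd k :=
  cubicCurve (Pi.single α e + Pi.single β c) (Pi.single α f + Pi.single β d)
    (Pi.single α (c * κ + d * ρ)) (Pi.single α (d * σ))

/-! ### A planar family of extremals contradicts convexity -/

section Core

variable {k : ℕ} {W : Set (Crd k)} {F : Crd k → Crd k → ℝ}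

theorem jet_planarField {α β : Fin k} (κ ρ σ e f c d t : ℝ) :
    planarField α β κ ρ σ e f c d t =
        (e + f * t + c * κ * t ^ 2 + d * (ρ * t ^ 2 + σ * t ^ 3)) • Pi.single α (1 : ℝ) +
          (c + d * t) • Pi.single β (1 : ℝ) ∧
      deriv (planarField α β κ ρ σ e f c d) t =
        (f + 2 * c * κ * t + d * (2 * ρ * t + 3 * σ * t ^ 2)) • Pi.single α (1 : ℝ) +
          d • Pi.single β (1 : ℝ) := by
  rw [planarField, deriv_cubicCurve]
  constructor
  · ext i
    simp only [cubicCurve, Pi.add_apply, Pi.smul_apply, smul_eq_mul, Pi.single_apply]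
    split_ifs <;> ring
  · ext i
    simp only [cubicCurve, Pi.add_apply, Pi.smul_apply, smul_eq_mul, Pi.single_apply,
      Pi.zero_apply]
    split_ifs <;> ring

/-- Expanding in the basis of the plane makes the pairings polynomials in `t` whose coefficients are
second derivatives of the Lagrangian. -/
theorem bilin_planar {V : Type*} [NormedAddCommGroup V] [NormedSpace ℝ V]
    (M : V × V →L[ℝ] V × V →L[ℝ] ℝ) (x y : V) (p s p' s' P S : ℝ) :
    M (p • x + s • y, p' • x + s' • y) (0, P • x + S • y) =
      p * P * M (x, 0) (0, x) + p * S * M (x, 0) (0, y) + s * P * M (y, 0) (0, x) +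
        s * S * M (y, 0) (0, y) + p' * P * M (0, x) (0, x) + p' * S * M (0, x) (0, y) +
        s' * P * M (0, y) (0, x) + s' * S * M (0, y) (0, y) := by
  have h1 : ((p • x + s • y, p' • x + s' • y) : V × V) =
      p • ((x, 0) : V × V) + s • ((y, 0) : V × V) + p' • ((0, x) : V × V) +
        s' • ((0, y) : V × V) := by simp
  have h2 : ((0, P • x + S • y) : V × V) = P • ((0, x) : V × V) + S • ((0, y) : V × V) := by simp
  rw [h1, h2]
  simp only [map_add, map_smul, add_apply, smul_apply,
    smul_eq_mul]
  ring

theorem IsFinsler.eulerLagrange_of_eventually (hF : IsFinsler W F) (hW : IsOpen W)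
    {c J : ℝ → Crd k} {t : ℝ} (hc : ContDiff ℝ ∞ c) (hJ : ContDiff ℝ ∞ J) (hcW : c t ∈ W)
    (hreg : deriv c t ≠ 0) (h : ∀ᶠ a : ℝ in 𝓝 0, IsExtremalAt F (fun s => c s + a • J s) t)
    (w : Crd k) : ∀ᶠ a : ℝ in 𝓝 0,
      fderiv ℝ (fderiv ℝ fun q : Crd k × Crd k => F q.1 q.2)
        ((c t, deriv c t) + a • (J t, deriv J t))
        ((deriv c t, deriv (deriv c) t) + a • (deriv J t, deriv (deriv J) t)) (0, w) =
      fderiv ℝ (fun q : Crd k × Crd k => F q.1 q.2)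
        ((c t, deriv c t) + a • (J t, deriv J t)) (w, 0) := by
  have hW' : ∀ᶠ a : ℝ in 𝓝 0, c t + a • J t ∈ W := by
    have : ContinuousAt (fun a : ℝ => c t + a • J t) 0 := by fun_prop
    exact this.eventually (hW.mem_nhds (by simpa using hcW))
  have hreg' : ∀ᶠ a : ℝ in 𝓝 0, deriv c t + a • deriv J t ≠ 0 := by
    have : ContinuousAt (fun a : ℝ => deriv c t + a • deriv J t) 0 := by fun_prop
    exact this.eventually_ne (by simpa using hreg)
  filter_upwards [h, hW', hreg'] with a ha haW hareg
  have hc1 := (contDiff_infty_iff_deriv.1 hc).2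
  have hJ1 := (contDiff_infty_iff_deriv.1 hJ).2
  have hd : deriv (fun s => c s + a • J s) = fun s => deriv c s + a • deriv J s := by
    funext s
    exact ((hc.differentiable (by simp) s).hasDerivAt.add
      ((hJ.differentiable (by simp) s).hasDerivAt.const_smul a)).deriv
  have hdd : deriv (fun s => deriv c s + a • deriv J s) t =
      deriv (deriv c) t + a • deriv (deriv J) t :=
    ((hc1.differentiable (by simp) t).hasDerivAt.add
      ((hJ1.differentiable (by simp) t).hasDerivAt.const_smul a)).deriv
  have := ha.eulerLagrange hF hW (hc.add (hJ.const_smul a)) haW (by rwa [hd]) w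
  rw [hd, hdd] at this
  exact this

/-- The constants `κ`, `σ` measure how a constant and a linear `β`-component force the
`α`-component. If `κ ≠ σ`, the constancy of the pairings is incompatible with a nonzero `F_vv` in
the direction `α`; `hdir` ensures that this direction is transverse to the motion. -/
theorem IsFinsler.false_of_planar_family (hF : IsFinsler W F) (hW : IsOpen W) {c : ℝ → Crd k}
    (hc : ContDiff ℝ ∞ c) {α β : Fin k} {κ ρ σ τ : ℝ} (hκ : κ ≠ σ)
    (hcW : c τ ∈ W) (hdir : ∃ i, i ≠ α ∧ deriv c τ i ≠ 0)
    (hext : ∀ᶠ t in 𝓝 τ, ∀ e f g d : ℝ, ∀ᶠ a : ℝ in 𝓝 0,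
      IsExtremalAt F (fun s => c s + a • planarField α β κ ρ σ e f g d s) t) : False := by
  obtain ⟨i₀, hi₀, hci₀⟩ := hdir
  have hreg : deriv c τ ≠ 0 := fun h => hci₀ (by simp [h])
  have hev : ∀ᶠ t in 𝓝 τ, (∀ e f g d : ℝ, ∀ᶠ a : ℝ in 𝓝 0,
      IsExtremalAt F (fun s => c s + a • planarField α β κ ρ σ e f g d s) t) ∧
      c t ∈ W ∧ deriv c t ≠ 0 :=
    hext.and ((hc.continuous.continuousAt.eventually (hW.mem_nhds hcW)).and
      ((contDiff_infty_iff_deriv.1 hc).2.continuous.continuousAt.eventually_ne hreg))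
  obtain ⟨ε, hε, hball⟩ := Metric.eventually_nhds_iff_ball.1 hev
  set G : Crd k × Crd k → ℝ := fun q => F q.1 q.2 with hG
  have hsm : ∀ e f g d : ℝ, ContDiff ℝ ∞ (planarField α β κ ρ σ e f g d) := fun e f g d =>
    contDiff_cubicCurve _ _ _ _
  have hconst : ∀ e f g d e' f' g' d' : ℝ, ∀ t ∈ Metric.ball τ ε,
      symplecticPairing G c (planarField α β κ ρ σ e f g d)
          (planarField α β κ ρ σ e' f' g' d') t =
        symplecticPairing G c (planarField α β κ ρ σ e f g d)
          (planarField α β κ ρ σ e' f' g' d') τ := by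
    intro e f g d e' f' g' d' t ht
    have hder : ∀ s ∈ Metric.ball τ ε, HasDerivAt
        (symplecticPairing G c (planarField α β κ ρ σ e f g d)
          (planarField α β κ ρ σ e' f' g' d')) 0 s := by
      intro s hs
      obtain ⟨h1, h2, h3⟩ := hball s hs
      refine hasDerivAt_symplecticPairing hc (hsm _ _ _ _) (hsm _ _ _ _)
        (hF.contDiffAt hW h2 h3) ?_
      rintro A (rfl | rfl) w
      · exact hF.eulerLagrange_of_eventually hW hc (hsm _ _ _ _) h2 h3 (h1 _ _ _ _) w
      · exact hF.eulerLagrange_of_eventually hW hc (hsm _ _ _ _) h2 h3 (h1 _ _ _ _) w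
    exact Metric.isOpen_ball.is_const_of_deriv_eq_zero (convex_ball τ ε).isPreconnected
      (fun s hs => (hder s hs).differentiableAt.differentiableWithinAt)
      (fun s hs => (hder s hs).deriv) ht (Metric.mem_ball_self hε)
  -- the pairings of the four basic fields
  set Ω₁₂ := symplecticPairing G c (planarField α β κ ρ σ 1 0 0 0)
    (planarField α β κ ρ σ 0 1 0 0) with hΩ₁₂
  set Ω₁₃ := symplecticPairing G c (planarField α β κ ρ σ 1 0 0 0)
    (planarField α β κ ρ σ 0 0 1 0) with hΩ₁₃
  set Ω₁₄ := symplecticPairing G c (planarField α β κ ρ σ 1 0 0 0)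
    (planarField α β κ ρ σ 0 0 0 1) with hΩ₁₄
  set Ω₂₃ := symplecticPairing G c (planarField α β κ ρ σ 0 1 0 0)
    (planarField α β κ ρ σ 0 0 1 0) with hΩ₂₃
  have h12 : ∀ t, Ω₁₂ t = -fderiv ℝ (fderiv ℝ G) (c t, deriv c t)
      (0, Pi.single α 1) (0, Pi.single α 1) := by
    intro t
    simp only [hΩ₁₂, symplecticPairing, (jet_planarField _ _ _ _ _ _ _ t).1,
      (jet_planarField _ _ _ _ _ _ _ t).2, bilin_planar]
    ring
  -- The factor `2 * t` removes the antisymmetrized position-velocity derivatives in `α` and `β`;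
  -- the mixed velocity derivatives of `Ω₂₃` and `Ω₁₄` cancel by symmetry.
  have hcomb : ∀ t ∈ Metric.ball τ ε, Ω₂₃ t + Ω₁₄ t - 2 * t * Ω₁₃ t =
      -(3 * (κ - σ) * t ^ 2 - 2 * ρ * t) * Ω₁₂ t := by
    intro t ht
    have hsymm := fderiv_fderiv_comm (hF.contDiffAt hW (hball t ht).2.1 (hball t ht).2.2)
      (0, Pi.single α 1) (0, Pi.single β 1)
    rw [← hG] at hsymm
    rw [h12]
    simp only [hΩ₁₃, hΩ₁₄, hΩ₂₃, symplecticPairing, (jet_planarField _ _ _ _ _ _ _ t).1,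
      (jet_planarField _ _ _ _ _ _ _ t).2, bilin_planar]
    linear_combination hsymm
  have hcomb' : ∀ t ∈ Metric.ball τ ε, Ω₂₃ τ + Ω₁₄ τ - 2 * t * Ω₁₃ τ =
      -(3 * (κ - σ) * t ^ 2 - 2 * ρ * t) * Ω₁₂ τ := by
    intro t ht
    have := hcomb t ht
    rwa [hΩ₁₂, hΩ₁₃, hΩ₁₄, hΩ₂₃, hconst _ _ _ _ _ _ _ _ t ht, hconst _ _ _ _ _ _ _ _ t ht,
      hconst _ _ _ _ _ _ _ _ t ht, hconst _ _ _ _ _ _ _ _ t ht] at this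
  -- A second difference kills the affine side and the `ρ` term, and isolates the coefficient of `t
  -- ^ 2`.
  have hzero : Ω₁₂ τ = 0 := by
    have e0 := hcomb' τ (Metric.mem_ball_self hε)
    have e1 := hcomb' (τ + ε / 2) (by simp [abs_of_pos hε]; linarith)
    have e2 := hcomb' (τ - ε / 2) (by simp [abs_of_pos hε]; linarith)
    have : (κ - σ) * ε ^ 2 * Ω₁₂ τ = 0 := by linear_combination (2 / 3) * (e1 + e2 - 2 * e0)
    have hne : (κ - σ) * ε ^ 2 ≠ 0 := mul_ne_zero (sub_ne_zero.2 hκ) (pow_ne_zero 2 hε.ne')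
    exact (mul_eq_zero.1 this).resolve_left hne
  rw [h12, neg_eq_zero] at hzero
  refine hF.hess_vel_ne_zero hW hcW hreg (fun a ha => ?_) hzero
  have ha0 : a = 0 := by
    have := congrFun ha i₀
    simpa [hi₀, hci₀] using this.symm
  have := congrFun ha α
  simp [ha0] at this

end Core

/-! ### Reparametrization of extremals -/

section Reparametrization

variable {k : ℕ} {W : Set (Crd k)} {F : Crd k → Crd k → ℝ}

/-- Momenta are homogeneous of degree zero in the velocity, as derivatives of a function of degree
one. -/
theorem IsFinsler.pd_vel_smul (hF : IsFinsler W F) (hW : IsOpen W) {x v : Crd k} (hx : x ∈ W)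
    (hv : v ≠ 0) {a : ℝ} (ha : 0 < a) (i : Fin k) : pd i (F x) (a • v) = pd i (F x) v := by
  have hav : a • v ≠ 0 := smul_ne_zero ha.ne' hv
  have h1 := (hF.hasFDerivAt_vel hW hx hav).differentiableAt.hasFDerivAt
  have h2 := (hF.hasFDerivAt_vel hW hx hv).differentiableAt.hasFDerivAt
  have h3 : HasFDerivAt (fun u => F x (a • u)) _ v :=
    h1.comp v ((hasFDerivAt_id v).const_smul a)
  have h4 : (fun u => F x (a • u)) =ᶠ[𝓝 v] fun u => a * F x u := by
    filter_upwards [isOpen_ne.mem_nhds hv] with u hu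
    exact hF.homog x hx u hu a ha
  have h5 := congrArg (fun A : Crd k →L[ℝ] ℝ => A (Pi.single i 1))
    (h3.unique ((h2.const_mul a).congr_of_eventuallyEq h4))
  simp only [ContinuousLinearMap.comp_apply, smul_apply, map_smul, smul_eq_mul,
    ContinuousLinearMap.id_apply] at h5
  exact mul_left_cancel₀ ha.ne' h5

theorem IsFinsler.pd_pos_smul (hF : IsFinsler W F) (hW : IsOpen W) {x v : Crd k} (hx : x ∈ W)
    (hv : v ≠ 0) {a : ℝ} (ha : 0 < a) (i : Fin k) :
    pd i (fun y => F y (a • v)) x = a * pd i (fun y => F y v) x := by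
  have h1 : (fun y => F y (a • v)) =ᶠ[𝓝 x] fun y => a * F y v := by
    filter_upwards [hW.mem_nhds hx] with y hy
    exact hF.homog y hy v hv a ha
  have h2 : DifferentiableAt ℝ (fun y => F y v) x :=
    DifferentiableAt.comp (g := fun q : Crd k × Crd k => F q.1 q.2) (f := fun y => (y, v)) x
      ((hF.contDiffAt hW hx hv).differentiableAt (by simp)) (by fun_prop)
  rw [pd, h1.fderiv_eq, fderiv_const_mul h2]
  simp [pd]

/-- The momenta are unchanged, while their time derivatives and the position derivatives of `F` both
acquire the factor `T'`. It must be positive, as `F` is only positively homogeneous. -/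
theorem IsExtremalAt.reparametrize (hF : IsFinsler W F) (hW : IsOpen W) {g c : ℝ → Crd k}
    {T T' : ℝ → ℝ} {t : ℝ}
    (hT : ∀ᶠ s in 𝓝 t, HasDerivAt T (T' s) s ∧ 0 < T' s ∧ c s = g (T s) ∧
      deriv c s = T' s • deriv g (T s) ∧ c s ∈ W ∧ deriv c s ≠ 0)
    (h : IsExtremalAt F g (T t)) : IsExtremalAt F c t := by
  intro i
  have hg : ∀ s, deriv c s = T' s • deriv g (T s) → deriv c s ≠ 0 → deriv g (T s) ≠ 0 :=
    fun s h1 h2 h3 => h2 (by rw [h1, h3, smul_zero])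
  obtain ⟨h1, h2, h3, h4, h5, h6⟩ := hT.self_of_nhds
  have hcomp := HasDerivAt.comp t (h i) h1
  rw [h3] at h5
  rw [h4, h3, hF.pd_pos_smul hW h5 (hg t h4 h6) h2, mul_comm]
  refine hcomp.congr_of_eventuallyEq ?_
  filter_upwards [hT] with s hs
  obtain ⟨_, k2, k3, k4, k5, k6⟩ := hs
  rw [k3] at k5
  rw [k4, k3, hF.pd_vel_smul hW k5 (hg s k4 k6) k2]
  rfl

end Reparametrization

/-- The inverse function theorem, on an interval small enough that the inverse takes values in `P`
and in the region of positive derivative. -/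
theorem exists_local_inverse {T : ℝ → ℝ} (hT : ContDiff ℝ ∞ T) {t : ℝ} (ht : 0 < deriv T t)
    {P : Set ℝ} (hP : P ∈ 𝓝 t) :
    ∃ (S : ℝ → ℝ) (I : Set ℝ), IsOpen I ∧ I.OrdConnected ∧ T t ∈ I ∧ ContDiffOn ℝ ∞ S I ∧
      (∀ x ∈ I, T (S x) = x ∧ 0 < deriv T (S x) ∧ S x ∈ P ∧
        HasDerivAt S (deriv T (S x))⁻¹ x) ∧ ∀ᶠ s in 𝓝 t, S (T s) = s := by
  have hd : ∀ s, HasDerivAt T (deriv T s) s := fun s => (hT.differentiable (by simp) s).hasDerivAt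
  have hcd : Continuous (deriv T) := (contDiff_infty_iff_deriv.1 hT).2.continuous
  let Φ := (hT.contDiffAt (x := t)).toOpenPartialHomeomorph T
    ((hd t).hasFDerivAt_equiv ht.ne') (by simp)
  have hΦ : (Φ : ℝ → ℝ) = T := rfl
  have htt : T t ∈ Φ.target :=
    (hT.contDiffAt (x := t)).image_mem_toOpenPartialHomeomorph_target
      ((hd t).hasFDerivAt_equiv ht.ne') (by simp)
  have hts : t ∈ Φ.source :=
    (hT.contDiffAt (x := t)).mem_toOpenPartialHomeomorph_source
      ((hd t).hasFDerivAt_equiv ht.ne') (by simp)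
  have hSt : Φ.symm (T t) = t := Φ.left_inv hts
  have hcont : Tendsto Φ.symm (𝓝 (T t)) (𝓝 t) := by
    have := (Φ.symm.continuousAt htt).tendsto
    rwa [hSt] at this
  have hev : ∀ᶠ x in 𝓝 (T t), x ∈ Φ.target ∧ 0 < deriv T (Φ.symm x) ∧ Φ.symm x ∈ P :=
    Filter.Eventually.and (Φ.open_target.mem_nhds htt)
      ((hcont.eventually (hcd.continuousAt.eventually (lt_mem_nhds ht))).and
        (hcont.eventually hP))
  obtain ⟨δ, hδ, hball⟩ := Metric.eventually_nhds_iff_ball.1 hev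
  refine ⟨Φ.symm, Metric.ball (T t) δ, Metric.isOpen_ball, (convex_ball _ _).ordConnected,
    Metric.mem_ball_self hδ, fun x hx => ?_, fun x hx => ?_, ?_⟩
  · obtain ⟨h1, h2, _⟩ := hball x hx
    exact (Φ.contDiffAt_symm_deriv h2.ne' h1 (hd _) hT.contDiffAt).contDiffWithinAt
  · obtain ⟨h1, h2, h3⟩ := hball x hx
    exact ⟨Φ.right_inv h1, h2, h3, Φ.hasDerivAt_symm h1 h2.ne' (hd _)⟩
  · filter_upwards [Φ.open_source.mem_nhds hts] with s hs
    exact Φ.left_inv hs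

/-! ### The Egorov structure -/

/-- An affinely parametrized path of the Egorov projective structure. -/
structure IsEgorovCurve {m : ℕ} (c : ℝ → Crd (m + 3)) : Prop where
  smooth : ContDiff ℝ ∞ c
  zero : ∀ s, deriv (deriv c) s 0 = -(2 * c s 1 * deriv c s 1 * deriv c s 2)
  succ : ∀ s (j : Fin (m + 2)), deriv (deriv c) s j.succ = 0

theorem two_ne_fin {m : ℕ} : (2 : Fin (m + 3)) ≠ 0 ∧ (2 : Fin (m + 3)) ≠ 1 := by
  have hv : ((2 : Fin (m + 3)) : ℕ) = 2 :=
    Nat.mod_eq_of_lt (Nat.le_add_left 3 m)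
  constructor <;>
  · intro h
    have := congrArg Fin.val h
    rw [hv] at this
    simp at this

theorem quadraticOf_egorovΓ {m : ℕ} (x v : Crd (m + 3)) (i : Fin (m + 3)) :
    quadraticOf (egorovΓ m) x v i = if i = 0 then 2 * x 1 * v 1 * v 2 else 0 := by
  have h21 := (two_ne_fin (m := m)).2
  by_cases hi : i = 0
  · simp only [quadraticOf, egorovΓ, hi, true_and, if_true]
    have : ∀ j l : Fin (m + 3), (if (j = 1 ∧ l = 2) ∨ (j = 2 ∧ l = 1) then x 1 else 0) * v j * v l =
        (if j = 1 then (if l = 2 then x 1 * v 1 * v 2 else 0) else 0) +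
          (if j = 2 then (if l = 1 then x 1 * v 1 * v 2 else 0) else 0) := by
      intro j l
      by_cases h1 : j = 1
      · by_cases h2 : l = 2
        · simp [h1, h2, h21.symm]
        · simp [h1, h2, h21.symm]
      · by_cases h2 : j = 2
        · by_cases h3 : l = 1
          · simp [h2, h3, h21]
            ring
          · simp [h2, h3, h21]
        · simp [h1, h2]
    simp only [this, Finset.sum_add_distrib, Finset.sum_ite_irrel, Finset.sum_const_zero,
      Finset.sum_ite_eq', Finset.mem_univ, if_true]
    ring
  · simp [quadraticOf, egorovΓ, hi]

theorem IsEgorovCurve.isPath {m : ℕ} {c : ℝ → Crd (m + 3)} (hc : IsEgorovCurve c) (I : Set ℝ) :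
    IsPath (quadraticOf (egorovΓ m)) I c := by
  refine ⟨0, fun t _ i => ?_⟩
  rw [quadraticOf_egorovΓ]
  refine Fin.cases ?_ (fun j => ?_) i
  · simp [hc.zero]
  · simp [hc.succ]

theorem IsEgorovCurve.isExtremalAt {m : ℕ} {W : Set (Crd (m + 3))}
    {F : Crd (m + 3) → Crd (m + 3) → ℝ} (hW : IsOpen W)
    (hmet : ∀ (I : Set ℝ) (γ : ℝ → Crd (m + 3)), IsRegularCurve W I γ →
      IsPath (quadraticOf (egorovΓ m)) I γ → IsExtremal F I γ)
    {c : ℝ → Crd (m + 3)} (hc : IsEgorovCurve c) {t : ℝ} (hcW : c t ∈ W) (hreg : deriv c t ≠ 0) :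
    IsExtremalAt F c t := by
  have hev : ∀ᶠ s in 𝓝 t, c s ∈ W ∧ deriv c s ≠ 0 :=
    (hc.smooth.continuous.continuousAt.eventually (hW.mem_nhds hcW)).and
      ((contDiff_infty_iff_deriv.1 hc.smooth).2.continuous.continuousAt.eventually_ne hreg)
  obtain ⟨ε, hε, hball⟩ := Metric.eventually_nhds_iff_ball.1 hev
  exact hmet (Metric.ball t ε) c ⟨Metric.isOpen_ball, (convex_ball _ _).ordConnected,
    hc.smooth.contDiffOn, fun s hs => (hball s hs).2, fun s hs => (hball s hs).1⟩
    (hc.isPath _) t (Metric.mem_ball_self hε)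

/-- Where `x⁰` increases it can serve as the parameter, and the affinely parametrized path becomes
the graph of a solution of (b). That graph is an extremal, and reparametrizing it back gives the
claim for `c`. -/
theorem IsEgorovCurve.isExtremalAt_of_ode {m : ℕ} {W : Set (Crd (m + 3))}
    {F : Crd (m + 3) → Crd (m + 3) → ℝ} (hF : IsFinsler W F) (hW : IsOpen W)
    (hmet : ∀ (I : Set ℝ) (y : ℝ → Crd (m + 2)), IsRegularCurve W I (graphCurve y) →
      IsSolution (egorovODE m) I y → IsExtremal F I (graphCurve y))
    {c : ℝ → Crd (m + 3)} (hc : IsEgorovCurve c) {t : ℝ} (hcW : c t ∈ W)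
    (hreg : 0 < deriv c t 0) : IsExtremalAt F c t := by
  have hc1 := (contDiff_infty_iff_deriv.1 hc.smooth).2
  have hdc : ∀ s, HasDerivAt c (deriv c s) s := fun s =>
    (hc.smooth.differentiable (by simp) s).hasDerivAt
  have hddc : ∀ s, HasDerivAt (deriv c) (deriv (deriv c) s) s := fun s =>
    (hc1.differentiable (by simp) s).hasDerivAt
  let T : ℝ → ℝ := fun s => c s 0
  have hT : ContDiff ℝ ∞ T := contDiff_pi.1 hc.smooth 0
  have hdT : deriv T = fun s => deriv c s 0 :=
    funext fun s => (hasDerivAt_pi.1 (hdc s) 0).deriv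
  obtain ⟨S, I, hIo, hIc, htI, hS, hI, hleft⟩ := exists_local_inverse hT (t := t)
    (by rwa [hdT]) (hc.smooth.continuous.continuousAt.preimage_mem_nhds (hW.mem_nhds hcW))
  simp only [hdT] at hI
  let y : ℝ → Crd (m + 2) := fun x j => c (S x) j.succ
  have hgc : ∀ x ∈ I, graphCurve y x = c (S x) := fun x hx => by
    funext i
    refine Fin.cases ?_ (fun j => rfl) i
    simp only [graphCurve, Fin.cons_zero]
    exact (hI x hx).1.symm
  have hdg : ∀ x ∈ I, HasDerivAt (graphCurve y) ((deriv c (S x) 0)⁻¹ • deriv c (S x)) x :=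
    fun x hx => ((hdc (S x)).scomp x (hI x hx).2.2.2).congr_of_eventuallyEq
      (Filter.mem_of_superset (hIo.mem_nhds hx) hgc)
  have hdy : ∀ x ∈ I, HasDerivAt y
      (fun j => (deriv c (S x) 0)⁻¹ * deriv c (S x) j.succ) x := fun x hx =>
    hasDerivAt_pi.2 fun j => hasDerivAt_pi.1 (hdg x hx) j.succ
  have hregular : IsRegularCurve W I (graphCurve y) := by
    refine ⟨hIo, hIc, (hc.smooth.comp_contDiffOn hS).congr hgc, fun x hx h => ?_,
      fun x hx => ?_⟩
    · rw [(hdg x hx).deriv] at h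
      have h0 := congrFun h 0
      have hp := (hI x hx).2.1
      simp [hp.ne'] at h0
    · rw [hgc x hx]
      exact (hI x hx).2.2.1
  have hsol : IsSolution (egorovODE m) I y := by
    intro x hx
    have hp := (hI x hx).2.1
    have hev : deriv y =ᶠ[𝓝 x] fun x j => (deriv c (S x) 0)⁻¹ * deriv c (S x) j.succ := by
      filter_upwards [hIo.mem_nhds hx] with x' hx'
      exact (hdy x' hx').deriv
    have hcS : HasDerivAt (fun x => deriv c (S x))
        ((deriv c (S x) 0)⁻¹ • deriv (deriv c) (S x)) x :=
      (hddc (S x)).scomp x (hI x hx).2.2.2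
    -- Only `x⁰` accelerates, so `ÿʲ = -x⁰'' xʲ' / (x⁰')³`, with primes for the affine parameter.
    have hdd : HasDerivAt (deriv y) (fun j => 2 * c (S x) 1 * deriv c (S x) 1 *
        deriv c (S x) 2 * (deriv c (S x) 0)⁻¹ ^ 3 * deriv c (S x) j.succ) x := by
      refine HasDerivAt.congr_of_eventuallyEq (hasDerivAt_pi.2 fun j => ?_) hev
      have h0 := (hasDerivAt_pi.1 hcS 0).inv hp.ne'
      refine (h0.mul (hasDerivAt_pi.1 hcS j.succ)).congr_deriv ?_
      simp only [Pi.smul_apply, smul_eq_mul, hc.zero, hc.succ]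
      field_simp
      simp
    rw [hdd.deriv]
    funext j
    simp only [egorovODE, (hdy x hx).deriv, y]
    have e1 : (Fin.succ 0 : Fin (m + 3)) = 1 := rfl
    have e2 : (Fin.succ 1 : Fin (m + 3)) = 2 := rfl
    rw [e1, e2]
    ring
  refine IsExtremalAt.reparametrize hF hW (T := T) (T' := fun s => deriv c s 0) (g := graphCurve y)
    ?_ (fun i => hmet I y hregular hsol (T t) htI i)
  have hTI : ∀ᶠ s in 𝓝 t, T s ∈ I := hT.continuous.continuousAt.eventually (hIo.mem_nhds htI)
  filter_upwards [hleft, hTI] with s hs hsI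
  have hp := (hI _ hsI).2.1
  have hsW := (hI _ hsI).2.2.1
  rw [hs] at hp hsW
  refine ⟨hasDerivAt_pi.1 (hdc s) 0, hp, ?_, ?_, hsW, fun h => ?_⟩
  · rw [hgc _ hsI, hs]
  · rw [(hdg _ hsI).deriv, hs, smul_smul, mul_inv_cancel₀ hp.ne', one_smul]
  · simp [h] at hp

/-- Here `x¹ = X 1 + s` and `x²' = a d`, so `x⁰'' = -2 a d (X 1 + s)`; integrating twice gives `ρ =
-X 1` and `σ = -1/3`. A constant shift of `x²` has no effect on `x⁰`, hence `κ = 0`. -/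
theorem isEgorovCurve_planar {m : ℕ} (X : Crd (m + 3)) (a e f g d : ℝ) :
    IsEgorovCurve fun s => cubicCurve X (Pi.single 0 1 + Pi.single 1 1) 0 0 s +
      a • planarField 0 2 0 (-X 1) (-1 / 3) e f g d s := by
  obtain ⟨h20, h21⟩ := two_ne_fin (m := m)
  have h10 : (1 : Fin (m + 3)) ≠ 0 := by simp
  simp only [planarField, cubicCurve_add_smul]
  refine ⟨contDiff_cubicCurve _ _ _ _, fun s => ?_, fun s j => ?_⟩
  · rw [deriv_cubicCurve, deriv_cubicCurve]
    simp [cubicCurve, h20, h21, h21.symm]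
    ring
  · rw [deriv_cubicCurve, deriv_cubicCurve]
    simp [cubicCurve]

/-- The base curve is the line through `X` in the direction `e₀ + e₁`: its `e₁`-component drives the
perturbations of `x⁰` and makes `e₀` transverse, and its `e₀`-component keeps `x⁰` increasing, as
the reduction of (b) needs. -/
theorem IsFinsler.false_of_egorov {m : ℕ} {W : Set (Crd (m + 3))}
    {F : Crd (m + 3) → Crd (m + 3) → ℝ} (hF : IsFinsler W F) (hW : IsOpen W) (hne : W.Nonempty)
    (h : ∀ (c : ℝ → Crd (m + 3)) (t : ℝ), IsEgorovCurve c → c t ∈ W → 0 < deriv c t 0 →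
      IsExtremalAt F c t) : False := by
  obtain ⟨X, hX⟩ := hne
  set c := cubicCurve X (Pi.single 0 1 + Pi.single 1 1) 0 0 with hc
  have hsm : ContDiff ℝ ∞ c := contDiff_cubicCurve _ _ _ _
  have hc0 : c 0 = X := by
    ext i
    simp [hc, cubicCurve]
  have hd : ∀ s, deriv c s = Pi.single 0 1 + Pi.single 1 1 := fun s => by
    rw [hc, deriv_cubicCurve]
    ext i
    simp [cubicCurve]
  refine hF.false_of_planar_family hW hsm (α := 0) (β := 2) (κ := 0) (ρ := -X 1) (σ := -1 / 3)
    (τ := 0) (by norm_num) (by rwa [hc0]) ⟨1, by simp, by simp [hd]⟩ ?_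
  filter_upwards [hsm.continuous.continuousAt.eventually (hW.mem_nhds (hc0.symm ▸ hX))]
    with t ht e f g d
  replace ht : c t ∈ W := ht
  set J := planarField (k := m + 3) 0 2 0 (-X 1) (-1 / 3) e f g d with hJ
  have hJs : ContDiff ℝ ∞ J := contDiff_cubicCurve _ _ _ _
  have h1 : ∀ᶠ a : ℝ in 𝓝 0, c t + a • J t ∈ W := by
    have : ContinuousAt (fun a : ℝ => c t + a • J t) 0 := by fun_prop
    exact this.eventually (hW.mem_nhds (by simpa using ht))
  have h2 : ∀ᶠ a : ℝ in 𝓝 0, 0 < deriv c t 0 + a * deriv J t 0 := by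
    have : ContinuousAt (fun a : ℝ => deriv c t 0 + a * deriv J t 0) 0 := by fun_prop
    exact this.eventually (lt_mem_nhds (by simp [hd]))
  filter_upwards [h1, h2] with a ha1 ha2
  refine h _ t (isEgorovCurve_planar X a e f g d) ha1 ?_
  have hder : deriv (fun s => c s + a • J s) t = deriv c t + a • deriv J t :=
    ((hsm.differentiable (by simp) t).hasDerivAt.add
      ((hJs.differentiable (by simp) t).hasDerivAt.const_smul a)).deriv
  rw [hder]
  exact ha2

theorem not_isFinslerMetrizable_egorov {m : ℕ} {W : Set (Crd (m + 3))} (hW : IsOpen W)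
    (hne : W.Nonempty) : ¬ IsFinslerMetrizable (quadraticOf (egorovΓ m)) W := by
  rintro ⟨F, hF, h⟩
  refine hF.false_of_egorov hW hne fun c t hc hcW hreg =>
    hc.isExtremalAt hW (fun I γ hγ => (h I γ hγ).2) hcW fun h0 => ?_
  simp [h0] at hreg

theorem not_isFinslerMetrizableODE_egorov {m : ℕ} {W : Set (Crd (m + 3))} (hW : IsOpen W)
    (hne : W.Nonempty) : ¬ IsFinslerMetrizableODE (egorovODE m) W := by
  rintro ⟨F, hF, h⟩
  exact hF.false_of_egorov hW hne fun c t hc hcW hreg =>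
    hc.isExtremalAt_of_ode hF hW (fun I y hy => (h I y hy).2) hcW hreg

/-! ### The linear equation -/

/-- The conditions on the zeroth components say that the parameter of the cubic curve is `x⁰`, so
the curve is already a graph. -/
theorem isExtremalAt_graphCurve_of_linearODE {m : ℕ} {W : Set (Crd (m + 3))}
    {F : Crd (m + 3) → Crd (m + 3) → ℝ} (hW : IsOpen W)
    (hmet : ∀ (I : Set ℝ) (y : ℝ → Crd (m + 2)), IsRegularCurve W I (graphCurve y) →
      IsSolution (linearODE m) I y → IsExtremal F I (graphCurve y))
    {A B C D : Crd (m + 3)} (hA : A 0 = 0) (hB : B 0 = 1) (hC : C 0 = 0) (hD : D 0 = 0)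
    (hsol : IsSolution (linearODE m) univ
      (cubicCurve (Fin.tail A) (Fin.tail B) (Fin.tail C) (Fin.tail D))) {t : ℝ}
    (hcW : cubicCurve A B C D t ∈ W) : IsExtremalAt F (cubicCurve A B C D) t := by
  have hgraph : graphCurve (cubicCurve (Fin.tail A) (Fin.tail B) (Fin.tail C) (Fin.tail D)) =
      cubicCurve A B C D := by
    funext s i
    refine Fin.cases ?_ (fun j => ?_) i
    · simp [graphCurve, cubicCurve, hA, hB, hC, hD]
    · simp [graphCurve, cubicCurve, Fin.tail]
  have hsm := contDiff_cubicCurve A B C D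
  obtain ⟨ε, hε, hball⟩ := Metric.eventually_nhds_iff_ball.1
    (hsm.continuous.continuousAt.eventually (hW.mem_nhds hcW))
  have h := hmet (Metric.ball t ε) _ (by
    rw [hgraph]
    refine ⟨Metric.isOpen_ball, (convex_ball _ _).ordConnected, hsm.contDiffOn,
      fun s _ h0 => ?_, hball⟩
    have := congrFun h0 0
    rw [deriv_cubicCurve] at this
    simp [cubicCurve, hB, hC, hD] at this) (fun x _ => hsol x (mem_univ x))
  rw [hgraph] at h
  exact h t (Metric.mem_ball_self hε)

theorem not_isFinslerMetrizableODE_linear {m : ℕ} {W : Set (Crd (m + 3))} (hW : IsOpen W)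
    (hne : W.Nonempty) : ¬ IsFinslerMetrizableODE (linearODE m) W := by
  rintro ⟨F, hF, h⟩
  obtain ⟨X, hX⟩ := hne
  obtain ⟨h20, h21⟩ := two_ne_fin (m := m)
  -- The base solution has `y² = X 2` constant and `y¹ = X 1 + X 2 (s² - X 0²) / 2`, so it passes
  -- through `X` at the time `X 0`.
  set A : Crd (m + 3) := X - Pi.single 0 (X 0) - Pi.single (M := fun _ => ℝ) 1 (X 2 * X 0 ^ 2 / 2) with hA
  set C : Crd (m + 3) := Pi.single (M := fun _ => ℝ) 1 (X 2 / 2) with hC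
  set c := cubicCurve A (Pi.single 0 1) C 0 with hc
  have hsm : ContDiff ℝ ∞ c := contDiff_cubicCurve _ _ _ _
  have hcX : c (X 0) = X := by
    ext i
    by_cases h0 : i = 0
    · subst h0; simp [hc, hA, hC, cubicCurve]
    · by_cases h1 : i = 1
      · subst h1; simp [hc, hA, hC, cubicCurve]; ring
      · simp [hc, hA, hC, cubicCurve, h0, h1]
  -- Integrating `ÿ¹ = y²` twice sends `1` to `s²/2` and `s` to `s³/6`, whence `κ` and `σ`.
  refine hF.false_of_planar_family hW hsm (α := 1) (β := 2) (κ := 1 / 2) (ρ := 0) (σ := 1 / 6)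
    (τ := X 0) (by norm_num) (by rwa [hcX])
    ⟨0, by simp, by rw [hc, deriv_cubicCurve]; simp [cubicCurve, hC]⟩ ?_
  filter_upwards [hsm.continuous.continuousAt.eventually (hW.mem_nhds (hcX.symm ▸ hX))]
    with t ht e f g d
  replace ht : c t ∈ W := ht
  have h1 : ∀ᶠ a : ℝ in 𝓝 0, c t + a • planarField 1 2 (1 / 2) 0 (1 / 6) e f g d t ∈ W := by
    have : ContinuousAt
      (fun a : ℝ => c t + a • planarField 1 2 (1 / 2) 0 (1 / 6) e f g d t) 0 := by fun_prop
    exact this.eventually (hW.mem_nhds (by simpa using ht))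
  filter_upwards [h1] with a ha
  simp only [hc, planarField, cubicCurve_add_smul] at ha ⊢
  refine isExtremalAt_graphCurve_of_linearODE hW (fun I y hy => (h I y hy).2)
    (by simp [hA, h20.symm]) (by simp [h20.symm]) (by simp [hC]) (by simp) ?_ ha
  intro x _
  rw [deriv_cubicCurve, deriv_cubicCurve]
  funext j
  have e1 : (Fin.succ 1 : Fin (m + 3)) = 2 := rfl
  by_cases hj : j = 0
  · subst hj
    simp [cubicCurve, linearODE, Fin.tail, hA, hC, e1, h20, h21]
    ring
  · have hj1 : j.succ ≠ 1 := fun hh => hj (Fin.succ_injective _ hh)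
    simp [cubicCurve, linearODE, Fin.tail, hC, hj, hj1]

end PathGeom

/-! ### The main theorem -/

theorem mainTheorem6 (m : ℕ) :
    -- non-metrizability of the three presentations, over every nonempty open set
    (∀ W : Set (Crd (m + 3)), IsOpen W → W.Nonempty →
      ¬ IsFinslerMetrizableODE (linearODE m) W ∧
      ¬ IsFinslerMetrizableODE (egorovODE m) W ∧
      ¬ IsFinslerMetrizable (quadraticOf (egorovΓ m)) W) ∧
    -- the general solution of the fundamental system
    (∀ (U : Set (Jet (m + 2))) (φ : Jet (m + 2) → Matrix (Fin (m + 2)) (Fin (m + 2)) ℝ),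
      IsOpen U → IsMetricField U φ →
      (FundamentalSystem (linearODE m) U φ ↔
        IsVelClosed U φ ∧
        ∀ z ∈ U, (∀ j, j ≠ 1 → φ z 0 j = 0) ∧ φ z 0 1 ≠ 0 ∧
          ∀ i j, totalDeriv (linearODE m) (fun z' => φ z' i j) z = 0)) ∧
    -- the resulting form of the homogeneous Lagrangian
    (∀ (U : Set (Jet (m + 2))) (Lhat : Crd (m + 3) → Crd (m + 3) → ℝ),
      IsOpen U →
      (∀ (x : ℝ) (y : Crd (m + 2)) (p : Crd (m + 1)),
        Set.OrdConnected {s : ℝ | (x, y, (Fin.cons s p : Crd (m + 2))) ∈ U}) →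
      ContDiffOn ℝ ∞ (fun q : Crd (m + 3) × Crd (m + 3) => Lhat q.1 q.2) (coneOver U) →
      (∀ q ∈ coneOver U, ∀ c : ℝ, 0 < c → Lhat q.1 (c • q.2) = c * Lhat q.1 q.2) →
      IsMetricField U (velHessian (dehomogenize Lhat)) →
      FundamentalSystem (linearODE m) U (velHessian (dehomogenize Lhat)) →
      ∃ ψ₀ ψ₁ : Crd (m + 3) → Crd (m + 1) → ℝ,
        ContDiffOn ℝ ∞ (fun r : Crd (m + 3) × Crd (m + 1) => ψ₀ r.1 r.2)
          ((fun q : Crd (m + 3) × Crd (m + 3) => (q.1, ratios q.2)) '' coneOver U) ∧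
        ContDiffOn ℝ ∞ (fun r : Crd (m + 3) × Crd (m + 1) => ψ₁ r.1 r.2)
          ((fun q : Crd (m + 3) × Crd (m + 3) => (q.1, ratios q.2)) '' coneOver U) ∧
        ∀ q ∈ coneOver U, Lhat q.1 q.2 = egorovForm (ψ₀ q.1) (ψ₁ q.1) q.2) ∧
    -- the square of such a Lagrangian is never strictly convex, nor strongly convex anywhere
    (∀ ψ₀ ψ₁ : Crd (m + 1) → ℝ,
      ¬ StrictConvexOn ℝ {v : Crd (m + 3) | 0 < v 0} (fun v => egorovForm ψ₀ ψ₁ v ^ 2) ∧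
      ∀ v : Crd (m + 3), v 0 ≠ 0 →
        ContDiffAt ℝ 2 ψ₀ (ratios v) → ContDiffAt ℝ 2 ψ₁ (ratios v) →
        ¬ HessPosDef (fun u => egorovForm ψ₀ ψ₁ u ^ 2) v) := by
  refine ⟨fun W hW hne => ⟨not_isFinslerMetrizableODE_linear hW hne,
    not_isFinslerMetrizableODE_egorov hW hne, not_isFinslerMetrizable_egorov hW hne⟩,
    fun U φ _ hφ => fundamentalSystem_linearODE_iff hφ,
    fun U Lhat hU hconn hL hhom hφ hfs => ?_,
    fun ψ₀ ψ₁ => ⟨not_strictConvexOn_egorovForm_sq ψ₀ ψ₁,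
      fun v hv h₀ h₁ => not_hessPosDef_egorovForm_sq hv h₀ h₁⟩⟩
  -- Of the solved fundamental system only `φ₁₁ = 0` is needed for the form of the Lagrangian.
  exact exists_egorovForm hU hconn hL hhom fun z hz =>
    (((fundamentalSystem_linearODE_iff hφ).1 hfs).2 z hz).1 0 (by simp)
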